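/- Let $D=[0,1]\times[0,1]$, let $0<\alpha\le 1$ and let $k_1,k_2,k_3:D\to\mathbb R$ be continuous. Let $W_2^{(3,2)}(D)$ be the space of functions $y:D\to\mathbb R$ such that $\frac{\partial^3 y}{\partial\xi^2\partial\eta}$ exists on $D$ and is completely continuous there (absolutely continuous in the sense of Carathéodory), $\frac{\partial^5 y}{\partial\xi^3\partial\eta^2}\in L^2(D)$, $y(\xi,0)=y(0,\eta)=y(1,\eta)=0$, and $\frac{\partial^3}{\partial\xi^3}\frac{\partial}{\partial\eta}y(\cdot,0)$, $\frac{\partial^2}{\partial\eta^2}\frac{\partial}{\partial\xi}y(0,\cdot)\in L^2(0,1)$ (so that the following inner product is finite), with $$\langle y,v\rangle_{W_2^{(3,2)}}=\sum_{i=0}^1\int_0^1\frac{\partial^2}{\partial\eta^2}\frac{\partial^i y}{\partial\xi^i}(0,\eta)\,\frac{\partial^2}{\partial\eta^2}\frac{\partial^i v}{\partial\xi^i}(0,\eta)\,d\eta+\int_0^1\frac{\partial^2y}{\partial\eta^2}(1,\eta)\frac{\partial^2v}{\partial\eta^2}(1,\eta)\,d\eta+\sum_{j=0}^1\Big\langle\frac{\partial^jy}{\partial\eta^j}(\cdot,0),\frac{\partial^jv}{\partial\eta^j}(\cdot,0)\Big\rangle_{W_2^3}+\int_0^1\!\!\int_0^1\frac{\partial^5y}{\partial\xi^3\partial\eta^2}\frac{\partial^5v}{\partial\xi^3\partial\eta^2}\,d\xi\,d\eta,$$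 where $\langle g,f\rangle_{W_2^3}=g(0)f(0)+g'(0)f'(0)+g(1)f(1)+\int_0^1g'''f'''\,d\xi$. Let $K_{(x,t)}(\xi,\eta)=R_x^{\{3\}}(\xi)R_t^{\{2\}}(\eta)$, where $$R_x^{\{3\}}(\xi)=-\tfrac1{120}(x-1)\xi\,(\xi x^4-4\xi x^3+6\xi x^2+x\xi^4-5x\xi^3-120x\xi+120x+\xi^4)\quad(\xi\le x),\qquad R_x^{\{3\}}(\xi)=R_\xi^{\{3\}}(x)\quad(\xi>x),$$ $$R_t^{\{2\}}(\eta)=\eta t+\tfrac12t\eta^2-\tfrac16\eta^3\quad(\eta\le t),\qquad R_t^{\{2\}}(\eta)=R_\eta^{\{2\}}(t)\quad(\eta>t).$$ For $y\in W_2^{(3,2)}(D)$ put $$Ly=D_\eta^\alpha y+k_1y_{\xi\xi}+k_2y+k_3y_\xi,$$ where $D^\alpha_\eta y(\xi,\eta)=\frac1{\Gamma(1-\alpha)}\int_0^\eta\frac{\partial_ry(\xi,r)}{(\eta-r)^\alpha}\,dr$ is the Caputo derivative if $\alpha<1$, and $D_\eta^1y=\partial_\eta y$. Then $K$ is the reproducing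 kernel of $W_2^{(3,2)}(D)$: $K_{(x,t)}\in W_2^{(3,2)}(D)$ and $\langle y,K_{(x,t)}\rangle_{W_2^{(3,2)}}=y(x,t)$ for all $(x,t)\in D$ and $y\in W_2^{(3,2)}(D)$. Moreover, let $(\xi_i,\eta_i)_{i\ge1}$ be a sequence of points of $D$ that is dense in $D$, assume that $L^{-1}$ exists, i.e. that $L$ is injective on $W_2^{(3,2)}(D)$, and let $$\psi_i(\xi,\eta)=L_{(x,t)}K_{(x,t)}(\xi,\eta)\big|_{(x,t)=(\xi_i,\eta_i)},$$ where the operator acts on the function $(x,t)\mapsto K_{(x,t)}(\xi,\eta)$. Then $\{\psi_i\}_{i=1}^\infty$ is a complete system in $W_2^{(3,2)}(D)$: every $\psi_i$ belongs to $W_2^{(3,2)}(D)$, the only $y\in W_2^{(3,2)}(D)$ with $\langle y,\psi_i\rangle_{W_2^{(3,2)}}=0$ for all $i$ is $y=0$, and the finite linear combinations of the $\psi_i$ are dense in $W_2^{(3,2)}(D)$ in the norm $\|y\|=\langle y,y\rangle^{1/2}$. -/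

import Mathlib

open MeasureTheory Set

noncomputable section

namespace BurgersRK

/-- The unit interval `[0,1]`. -/
abbrev I : Set ℝ := Icc 0 1

/-- The closed unit square `D = [0,1] × [0,1]`. A function on `D` is represented by
`y : ℝ → ℝ → ℝ`, of which only the values `y ξ η` with `(ξ, η) ∈ D` are ever used;
two such functions are the same function on `D` when `EqOnD` holds. -/
abbrev D : Set (ℝ × ℝ) := I ×ˢ I

/-- `y` and `v` are the same function on `D`. -/
def EqOnD (y v : ℝ → ℝ → ℝ) : Prop :=
  ∀ ξ ∈ I, ∀ η ∈ I, y ξ η = v ξ η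

/-- Derivative of a function on `[0,1]` (one-sided at the end points). -/
def dI (f : ℝ → ℝ) : ℝ → ℝ := fun s => derivWithin f I s

/-- Partial derivative `∂/∂ξ` (first variable) of a function on `D`. -/
def dx (y : ℝ → ℝ → ℝ) : ℝ → ℝ → ℝ :=
  fun ξ η => derivWithin (fun s => y s η) I ξ

/-- Partial derivative `∂/∂η` (second variable) of a function on `D`. -/
def dt (y : ℝ → ℝ → ℝ) : ℝ → ℝ → ℝ :=
  fun ξ η => derivWithin (fun r => y ξ r) I η

/-- Complete (that is, absolute) continuity on `D` of a function of two variables, in the sense of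
Carathéodory: `w` is an indefinite integral of integrable densities. -/
def AbsContOnD (w : ℝ → ℝ → ℝ) : Prop :=
  ∃ (g h : ℝ → ℝ) (k : ℝ × ℝ → ℝ),
    IntegrableOn g I ∧ IntegrableOn h I ∧ IntegrableOn k D ∧
    ∀ ξ ∈ I, ∀ η ∈ I,
      w ξ η = w 0 0 + (∫ s in Icc 0 ξ, g s) + (∫ r in Icc 0 η, h r)
        + ∫ q in Icc 0 ξ ×ˢ Icc 0 η, k q

/-- `k ∈ L²(D)` is the mixed derivative `∂²w/∂ξ∂η` of the absolutely continuous function `w`,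
i.e. the density of its rectangular increments. Such a `k` is unique up to a null subset
of `D`. -/
def IsMixedDeriv (w : ℝ → ℝ → ℝ) (k : ℝ × ℝ → ℝ) : Prop :=
  MemLp k 2 (volume.restrict D) ∧
    ∀ ξ ∈ I, ∀ η ∈ I,
      w ξ η - w 0 η - w ξ 0 + w 0 0 = ∫ q in Icc 0 ξ ×ˢ Icc 0 η, k q

/-- The function `∂³y/∂ξ²∂η`. -/
def d21 (y : ℝ → ℝ → ℝ) : ℝ → ℝ → ℝ := dx (dx (dt y))

open Classical in
/-- The function `∂⁵y/∂ξ³∂η² ∈ L²(D)`, determined up to a null set: the mixed derivative of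
`∂³y/∂ξ²∂η` (and `0` if there is none in `L²(D)`, which does not happen in the space below). -/
def d32 (y : ℝ → ℝ → ℝ) : ℝ × ℝ → ℝ :=
  if h : ∃ k, IsMixedDeriv (d21 y) k then h.choose else 0

/-- Membership in the space `W₂^{(3,2)}(D)`: the derivative `∂³y/∂ξ²∂η` exists on `D` and is
completely continuous there, `∂⁵y/∂ξ³∂η² ∈ L²(D)`, `y(ξ,0) = y(0,η) = y(1,η) = 0`, and the
two boundary derivatives that occur under the remaining (one-dimensional) integrals of the
inner product are square integrable, so that the inner product is finite. (The other boundary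
terms of the inner product vanish by the boundary conditions.) -/
structure MemW32 (y : ℝ → ℝ → ℝ) : Prop where
  diff_t : ∀ ξ ∈ I, ∀ η ∈ I, DifferentiableWithinAt ℝ (fun r => y ξ r) I η
  diff_xt : ∀ ξ ∈ I, ∀ η ∈ I, DifferentiableWithinAt ℝ (fun s => dt y s η) I ξ
  diff_xxt : ∀ ξ ∈ I, ∀ η ∈ I, DifferentiableWithinAt ℝ (fun s => dx (dt y) s η) I ξ
  absCont : AbsContOnD (d21 y)
  mixed : ∃ k, IsMixedDeriv (d21 y) k
  edge_x : MemLp (fun ξ => dx (dx (dx (dt y))) ξ 0) 2 (volume.restrict I)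
  edge_t : MemLp (fun η => dt (dt (dx y)) 0 η) 2 (volume.restrict I)
  initial : ∀ ξ ∈ I, y ξ 0 = 0
  left : ∀ η ∈ I, y 0 η = 0
  right : ∀ η ∈ I, y 1 η = 0

/-- The inner product of `W₂³[0,1]`. -/
def inner3 (g f : ℝ → ℝ) : ℝ :=
  g 0 * f 0 + dI g 0 * dI f 0 + g 1 * f 1 + ∫ s in I, dI (dI (dI g)) s * dI (dI (dI f)) s

/-- The inner product of `W₂^{(3,2)}(D)`. -/
def inner32 (y v : ℝ → ℝ → ℝ) : ℝ :=
  (∫ η in I, dt (dt y) 0 η * dt (dt v) 0 η)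
  + (∫ η in I, dt (dt (dx y)) 0 η * dt (dt (dx v)) 0 η)
  + (∫ η in I, dt (dt y) 1 η * dt (dt v) 1 η)
  + inner3 (fun ξ => y ξ 0) (fun ξ => v ξ 0)
  + inner3 (fun ξ => dt y ξ 0) (fun ξ => dt v ξ 0)
  + ∫ q in D, d32 y q * d32 v q

/-- The norm of `W₂^{(3,2)}(D)`. -/
def norm32 (y : ℝ → ℝ → ℝ) : ℝ := Real.sqrt (inner32 y y)

/-- `K x t` (as a function of `(ξ, η)`) is the reproducing kernel of `W₂^{(3,2)}(D)`. -/
def IsReproducingKernel32 (K : ℝ → ℝ → ℝ → ℝ → ℝ) : Prop :=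
  ∀ x ∈ I, ∀ t ∈ I, MemW32 (K x t) ∧ ∀ y, MemW32 y → inner32 y (K x t) = y x t

/-- A sequence in `W₂^{(3,2)}(D)` is a complete system: its members lie in the space, only zero
is orthogonal to all of them, and their finite linear combinations are dense in the norm. -/
def IsCompleteSystem32 (ψ : ℕ → ℝ → ℝ → ℝ) : Prop :=
  (∀ i, MemW32 (ψ i)) ∧
  (∀ y, MemW32 y → (∀ i, inner32 y (ψ i) = 0) → EqOnD y (fun _ _ => 0)) ∧
  (∀ y, MemW32 y → ∀ ε > 0, ∃ (n : ℕ) (c : ℕ → ℝ),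
    norm32 (fun ξ η => y ξ η - ∑ i ∈ Finset.range n, c i * ψ i ξ η) < ε)

/-- The kernel `R_t^{2}(η)` of `W₂²[0,1]`. -/
def R2 (t η : ℝ) : ℝ :=
  if η ≤ t then η * t + 1 / 2 * t * η ^ 2 - 1 / 6 * η ^ 3
  else -(1 / 6) * t ^ 3 + 1 / 2 * η * t ^ 2 + t * η

/-- The kernel `R_x^{3}(ξ)` of `W₂³[0,1]`. -/
def R3 (x ξ : ℝ) : ℝ :=
  if ξ ≤ x then
    -1 / 120 * (x - 1) * ξ * (ξ * x ^ 4 - 4 * ξ * x ^ 3 + 6 * ξ * x ^ 2 + x * ξ ^ 4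
      - 5 * x * ξ ^ 3 - 120 * x * ξ + 120 * x + ξ ^ 4)
  else
    -1 / 120 * (ξ - 1) * x * (x * ξ ^ 4 - 4 * x * ξ ^ 3 + 6 * x * ξ ^ 2 + ξ * x ^ 4
      - 5 * ξ * x ^ 3 - 120 * ξ * x + 120 * ξ + x ^ 4)

/-- The kernel `K_{(x,t)}(ξ,η) = R_x^{3}(ξ) R_t^{2}(η)`, written `K32 x t ξ η`. -/
def K32 (x t ξ η : ℝ) : ℝ := R3 x ξ * R2 t η

open Classical in
/-- Caputo derivative of order `α ∈ (0,1]` in the second variable; for `α = 1` it is `∂/∂η`. -/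
def caputo (α : ℝ) (y : ℝ → ℝ → ℝ) (ξ η : ℝ) : ℝ :=
  if α = 1 then dt y ξ η
  else 1 / Real.Gamma (1 - α) * ∫ r in Icc 0 η, dt y ξ r / (η - r) ^ α

/-- The linear operator `L y = D_η^α y + k₁ y_ξξ + k₂ y + k₃ y_ξ`. -/
def opL (α : ℝ) (k₁ k₂ k₃ : ℝ → ℝ → ℝ) (y : ℝ → ℝ → ℝ) (ξ η : ℝ) : ℝ :=
  caputo α y ξ η + k₁ ξ η * dx (dx y) ξ η + k₂ ξ η * y ξ η + k₃ ξ η * dx y ξ η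

/-- `L⁻¹` exists: `L` is injective on `W₂^{(3,2)}(D)` (functions being compared on `D`). -/
def HasInverse (L : (ℝ → ℝ → ℝ) → ℝ → ℝ → ℝ) : Prop :=
  ∀ y v, MemW32 y → MemW32 v → EqOnD (L y) (L v) → EqOnD y v

/-- `ψ_i(ξ,η) = L_{(x,t)} K_{(x,t)}(ξ,η)` at `(x,t) = (ξ_i,η_i) = p i`: the operator acts on the
function `(x,t) ↦ K_{(x,t)}(ξ,η)`. -/
def psi (L : (ℝ → ℝ → ℝ) → ℝ → ℝ → ℝ) (p : ℕ → ℝ × ℝ) (i : ℕ) (ξ η : ℝ) : ℝ :=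
  L (fun x t => K32 x t ξ η) (p i).1 (p i).2

end BurgersRK

end

namespace BurgersRK

/-! The space is isometric to an `L²` space, and in that model every assertion is elementary.
Taylor's formula, with the second derivative at 0 eliminated through u(1) = 0, shows that a function
u with u(0) = u(1) = 0 satisfies u(x) = u'(0)(x - x²) + ∫ ((x-s)₊²/2 - x²(1-s)²/2) u'''(s) ds.
Likewise w(0) = 0 gives w(t) = t w'(0) + ∫ (t-r)₊ w''(r) dr. Recording the scalars u'(0), w'(0) at
an atom placed at -1 turns these into integrals of one density against the kernels `Φ0` and `Ψ0` for
the measure `ν`.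

In two variables, y is `Y f`, the integral of f against `Φ0 ξ` ⊗ `Ψ0 η` for `μ` = `ν` × `ν`. The
four pieces of `μ` carry y_ξη(0,0), y_ξξξη(·,0), y_ξηη(0,·) and y_ξξξηη. The boundary conditions
kill all other terms of the inner product, so it becomes the `L²(μ)` product of densities
(`inner32_Y`), and every member of the space has such a density (`MemW32.exists_density`). The
polynomials in K are the Gram integrals of `Φ0` and `Ψ0` (`R3_eq`, `R2_eq`), so K_(x,t) has density
`Φ0 x` ⊗ `Ψ0 t`, and reproduction is the definition of `Y`.

Derivatives, including the Caputo one, fall on the kernels, so L y(z) is the `L²` pairing of the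
density of y with a fixed `evalL z` (`opL_eq_integral`). By symmetry of K, ψ_i has density `evalL`
at the i-th point (`eqOnD_psi`). Orthogonality to all ψ_i thus says that L y vanishes at a dense set
of points; L y is continuous, hence zero, and injectivity gives y = 0. Density of the span is then
the Hilbert space criterion in `L²(μ)`. -/

/-! ### Derivatives on the unit interval and square -/

lemma zero_mem_I : (0 : ℝ) ∈ I := ⟨le_rfl, zero_le_one⟩

lemma one_mem_I : (1 : ℝ) ∈ I := ⟨zero_le_one, le_rfl⟩

lemma Icc_zero_subset_I {x : ℝ} (hx : x ∈ I) : Icc 0 x ⊆ I := Icc_subset_Icc le_rfl hx.2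

lemma uniqueDiffWithinAt_I {x : ℝ} (hx : x ∈ I) : UniqueDiffWithinAt ℝ I x :=
  uniqueDiffOn_Icc_zero_one x hx

lemma EqOnD.trans {y v w : ℝ → ℝ → ℝ} (h : EqOnD y v) (h' : EqOnD v w) : EqOnD y w :=
  fun ξ hξ η hη => (h ξ hξ η hη).trans (h' ξ hξ η hη)

/-- If every slice of `F` in the first variable has derivative `G`, so does any function that
agrees with `F` on the square. -/
lemma EqOnD.hasDerivWithinAt_fst {y F G : ℝ → ℝ → ℝ} (h : EqOnD y F)
    (hF : ∀ ξ ∈ I, ∀ η ∈ I, HasDerivAt (fun s => F s η) (G ξ η) ξ) {ξ η : ℝ} (hξ : ξ ∈ I)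
    (hη : η ∈ I) : HasDerivWithinAt (fun s => y s η) (G ξ η) I ξ :=
  (hF ξ hξ η hη).hasDerivWithinAt.congr (fun s hs => h s hs η hη) (h ξ hξ η hη)

lemma EqOnD.hasDerivWithinAt_snd {y F G : ℝ → ℝ → ℝ} (h : EqOnD y F)
    (hF : ∀ ξ ∈ I, ∀ η ∈ I, HasDerivAt (fun r => F ξ r) (G ξ η) η) {ξ η : ℝ} (hξ : ξ ∈ I)
    (hη : η ∈ I) : HasDerivWithinAt (fun r => y ξ r) (G ξ η) I η :=
  (hF ξ hξ η hη).hasDerivWithinAt.congr (fun s hs => h ξ hξ s hs) (h ξ hξ η hη)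

lemma EqOnD.dx_eq {y F G : ℝ → ℝ → ℝ} (h : EqOnD y F)
    (hF : ∀ ξ ∈ I, ∀ η ∈ I, HasDerivAt (fun s => F s η) (G ξ η) ξ) : EqOnD (dx y) G :=
  fun _ hξ _ hη => (h.hasDerivWithinAt_fst hF hξ hη).derivWithin (uniqueDiffWithinAt_I hξ)

lemma EqOnD.dt_eq {y F G : ℝ → ℝ → ℝ} (h : EqOnD y F)
    (hF : ∀ ξ ∈ I, ∀ η ∈ I, HasDerivAt (fun r => F ξ r) (G ξ η) η) : EqOnD (dt y) G :=
  fun _ hξ _ hη => (h.hasDerivWithinAt_snd hF hξ hη).derivWithin (uniqueDiffWithinAt_I hη)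

lemma dI_congr {u v : ℝ → ℝ} (h : ∀ x ∈ I, u x = v x) : ∀ x ∈ I, dI u x = dI v x :=
  fun x hx => derivWithin_congr h (h x hx)

lemma dI_eq_zero {u : ℝ → ℝ} (h : ∀ x ∈ I, u x = 0) : ∀ x ∈ I, dI u x = 0 := fun x hx => by
  rw [dI_congr (v := fun _ => 0) h x hx]
  simp [dI]

/-! ### Uniqueness of densities -/

/-- Lebesgue differentiation of a primitive on `[0,1]`. -/
lemma dI_primitive_ae {u g : ℝ → ℝ} {c : ℝ} (hg : IntegrableOn g I)
    (h : ∀ x ∈ I, u x = c + ∫ s in Icc 0 x, g s) : dI u =ᵐ[volume.restrict I] g := by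
  have hint : IntervalIntegrable g volume 0 1 :=
    (intervalIntegrable_iff_integrableOn_Icc_of_le zero_le_one).2 hg
  have h1 := hint.ae_hasDerivAt_integral
  filter_upwards [ae_restrict_of_ae h1, ae_restrict_mem measurableSet_Icc] with x hx hxI
  have hd := (hx (by simpa using hxI) 0 (by simp)).const_add c
  refine ((hd.hasDerivWithinAt (s := I)).congr (fun z hz => ?_) ?_).derivWithin
    (uniqueDiffWithinAt_I hxI)
  · rw [h z hz, intervalIntegral.integral_of_le hz.1, integral_Icc_eq_integral_Ioc]
  · rw [h x hxI, intervalIntegral.integral_of_le hxI.1, integral_Icc_eq_integral_Ioc]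

lemma ae_eq_zero_of_primitive_eq_zero {g : ℝ → ℝ} (hg : IntegrableOn g I)
    (h : ∀ x ∈ I, ∫ s in Icc 0 x, g s = 0) : g =ᵐ[volume.restrict I] 0 := by
  have h1 := dI_primitive_ae (u := fun _ => 0) (c := 0) hg (fun x hx => by rw [h x hx, add_zero])
  filter_upwards [h1, ae_restrict_mem measurableSet_Icc] with x hx hxI
  rw [← hx, dI_eq_zero (fun _ _ => rfl) x hxI, Pi.zero_apply]

lemma volume_restrict_D :
    (volume.restrict D : Measure (ℝ × ℝ)) = (volume.restrict I).prod (volume.restrict I) := by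
  rw [Measure.prod_restrict]; rfl

instance isFiniteMeasure_restrict_D : IsFiniteMeasure (volume.restrict D : Measure (ℝ × ℝ)) := by
  rw [volume_restrict_D]; infer_instance

/-- An integrable function on the square with vanishing integrals over all rectangles with a
corner at the origin vanishes almost everywhere. -/
lemma ae_eq_zero_of_rectangle_integral_eq_zero {k : ℝ × ℝ → ℝ} (hk : IntegrableOn k D)
    (h : ∀ ξ ∈ I, ∀ η ∈ I, ∫ q in Icc 0 ξ ×ˢ Icc 0 η, k q = 0) :
    k =ᵐ[volume.restrict D] 0 := by
  have hkp : Integrable k ((volume.restrict I).prod (volume.restrict I)) := by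
    rw [← volume_restrict_D]; exact hk
  -- For fixed η the rectangle integral is a primitive in the first variable, so its integrand
  -- vanishes for almost every s.
  have hslice : ∀ η ∈ I, (fun s => ∫ r in Icc 0 η, k (s, r)) =ᵐ[volume.restrict I] 0 := by
    intro η hη
    have hkη : IntegrableOn k (I ×ˢ Icc 0 η) :=
      hk.mono_set (prod_mono le_rfl (Icc_zero_subset_I hη))
    have hkη' : Integrable k ((volume.restrict I).prod (volume.restrict (Icc 0 η))) := by
      rw [Measure.prod_restrict]; exact hkη
    refine ae_eq_zero_of_primitive_eq_zero hkη'.integral_prod_left (fun x hx => ?_)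
    refine Eq.trans ?_ (h x hx η hη)
    exact (setIntegral_prod (μ := volume) (ν := volume) k
      (hk.mono_set (prod_mono (Icc_zero_subset_I hx) (Icc_zero_subset_I hη)))).symm
  -- The exceptional null set depends on η; restricting to rational η makes the union countable, and
  -- continuity of the primitive in η restores all of [0,1].
  have hrat : ∀ᵐ s ∂(volume.restrict I), ∀ q : ℚ, (q : ℝ) ∈ I →
      ∫ r in Icc 0 (q : ℝ), k (s, r) = 0 := by
    rw [ae_all_iff]
    intro q
    by_cases hq : (q : ℝ) ∈ I
    · filter_upwards [hslice q hq] with s hs _ using hs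
    · exact Filter.Eventually.of_forall fun _ h => (hq h).elim
  rw [volume_restrict_D]
  have hslice0 : ∀ᵐ s ∂(volume.restrict I), ∫ r in I, ‖k (s, r)‖ = 0 := by
    filter_upwards [hrat, hkp.prod_right_ae] with s hs hint
    have hcont : ContinuousOn (fun x => ∫ r in Icc 0 x, k (s, r)) I :=
      intervalIntegral.continuousOn_primitive_Icc hint
    have hEq : EqOn (fun x => ∫ r in Icc 0 x, k (s, r)) (fun _ => 0) I := by
      refine EqOn.of_subset_closure (s := Ioo 0 1 ∩ range ((↑) : ℚ → ℝ)) ?_ hcont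
        continuousOn_const (fun x hx => Ioo_subset_Icc_self hx.1) ?_
      · rintro _ ⟨hx, q, rfl⟩
        exact hs q (Ioo_subset_Icc_self hx)
      · have := closure_mono (Dense.open_subset_closure_inter Rat.denseRange_cast
          (isOpen_Ioo (a := (0 : ℝ)) (b := 1)))
        rwa [closure_closure, closure_Ioo zero_ne_one] at this
    have h0 := ae_eq_zero_of_primitive_eq_zero (g := fun r => k (s, r)) hint hEq
    rw [integral_congr_ae (g := fun _ => (0 : ℝ))]
    · simp
    · filter_upwards [h0] with r hr
      simp [hr]
  have hnorm : ∫ q, ‖k q‖ ∂((volume.restrict I).prod (volume.restrict I)) = 0 := by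
    rw [integral_prod _ hkp.norm, integral_congr_ae hslice0]
    simp
  have := (integral_eq_zero_iff_of_nonneg (fun q => norm_nonneg (k q)) hkp.norm).1 hnorm
  filter_upwards [this] with q hq
  simpa using hq

/-! ### The model measure -/

/-- Lebesgue measure on `[0,1]` together with an atom at `-1`, which carries the boundary data. -/
noncomputable def ν : Measure ℝ := Measure.dirac (-1) + volume.restrict I

instance : IsFiniteMeasure ν := by unfold ν; infer_instance

/-- The measure on the plane whose `L²` space is a model of `W₂^{(3,2)}(D)`. -/
noncomputable def μ : Measure (ℝ × ℝ) := ν.prod ν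

instance : IsFiniteMeasure μ := by unfold μ; infer_instance

lemma ae_ν_iff {P : ℝ → Prop} :
    (∀ᵐ s ∂ν, P s) ↔ P (-1) ∧ ∀ᵐ s ∂(volume.restrict I), P s := by
  rw [ν, ae_add_measure_iff, ae_dirac_eq, Filter.eventually_pure]

lemma ae_ν_mem : ∀ᵐ s ∂ν, s ∈ Icc (-1 : ℝ) 1 :=
  ae_ν_iff.2 ⟨by norm_num, (ae_restrict_mem measurableSet_Icc).mono
    fun s hs => ⟨by linarith [hs.1], hs.2⟩⟩

/-- The only atom lies outside [0,1], so the kinks and jumps of the kernels at s = x are negligible.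
-/
lemma ae_ν_ne {x : ℝ} (hx : x ∈ I) : ∀ᵐ s ∂ν, s ≠ x :=
  ae_ν_iff.2 ⟨by linarith [hx.1], ae_restrict_of_ae (by simp [ae_iff])⟩

lemma ae_ν_ne_zero : ∀ᵐ s ∂ν, s ≠ 0 := ae_ν_ne zero_mem_I

lemma quasi_fst : Measure.QuasiMeasurePreserving Prod.fst μ ν := Measure.quasiMeasurePreserving_fst

lemma quasi_snd : Measure.QuasiMeasurePreserving Prod.snd μ ν := Measure.quasiMeasurePreserving_snd

lemma ae_μ_mem : ∀ᵐ q ∂μ, q.1 ∈ Icc (-1 : ℝ) 1 ∧ q.2 ∈ Icc (-1 : ℝ) 1 :=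
  (quasi_fst.ae ae_ν_mem).and (quasi_snd.ae ae_ν_mem)

lemma μ_eq : μ = Measure.dirac (-1, -1) + (volume.restrict I).map (fun s => (s, (-1 : ℝ)))
    + ((volume.restrict I).map (Prod.mk (-1)) + volume.restrict D) := by
  rw [μ, ν, Measure.prod_add, Measure.add_prod, Measure.add_prod, Measure.prod_dirac,
    Measure.prod_dirac, Measure.dirac_prod, volume_restrict_D, Measure.map_dirac' (by fun_prop)]

lemma measurableEmbedding_mk_left : MeasurableEmbedding (Prod.mk (-1 : ℝ) : ℝ → ℝ × ℝ) :=
  measurableEmbedding_prodMk_left _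

lemma measurableEmbedding_mk_right : MeasurableEmbedding (fun s : ℝ => (s, (-1 : ℝ))) :=
  measurableEmbedding_prod_mk_right _

lemma integrable_μ_iff {F : ℝ × ℝ → ℝ} :
    Integrable F μ ↔ IntegrableOn (fun s => F (s, -1)) I ∧ IntegrableOn (fun r => F (-1, r)) I ∧
      IntegrableOn F D := by
  rw [μ_eq, integrable_add_measure, integrable_add_measure, integrable_add_measure,
    measurableEmbedding_mk_left.integrable_map_iff, measurableEmbedding_mk_right.integrable_map_iff]
  have : Integrable F (Measure.dirac ((-1 : ℝ), (-1 : ℝ))) := integrable_dirac (by simp)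
  simp only [this, true_and, IntegrableOn, Function.comp_def]

lemma integral_μ {F : ℝ × ℝ → ℝ} (hF : Integrable F μ) :
    ∫ q, F q ∂μ = F (-1, -1) + (∫ s in I, F (s, -1)) + (∫ r in I, F (-1, r)) + ∫ q in D, F q := by
  have hF' := hF
  rw [μ_eq, integrable_add_measure, integrable_add_measure, integrable_add_measure] at hF'
  obtain ⟨⟨h1, h2⟩, h3, h4⟩ := hF'
  rw [μ_eq, integral_add_measure (h1.add_measure h2) (h3.add_measure h4),
    integral_add_measure h1 h2, integral_add_measure h3 h4,
    measurableEmbedding_mk_left.integral_map, measurableEmbedding_mk_right.integral_map,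
    integral_dirac]
  ring

lemma memLp_μ_iff {F : ℝ × ℝ → ℝ} :
    MemLp F 2 μ ↔ MemLp (fun s => F (s, -1)) 2 (volume.restrict I) ∧
      MemLp (fun r => F (-1, r)) 2 (volume.restrict I) ∧ MemLp F 2 (volume.restrict D) := by
  -- The splitting of `μ` is available for integrability; measurability on each piece is recovered
  -- from integrability of F itself.
  have key : MemLp F 2 μ ↔ AEStronglyMeasurable F μ ∧ Integrable (fun q => F q ^ 2) μ :=
    ⟨fun h => ⟨h.1, (memLp_two_iff_integrable_sq h.1).1 h⟩,
      fun h => (memLp_two_iff_integrable_sq h.1).2 h.2⟩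
  constructor
  · intro h
    obtain ⟨h1, h2⟩ := key.1 h
    have hi := integrable_μ_iff.1 (h.integrable one_le_two)
    have hi2 := integrable_μ_iff.1 h2
    exact ⟨(memLp_two_iff_integrable_sq hi.1.1).2 hi2.1,
      (memLp_two_iff_integrable_sq hi.2.1.1).2 hi2.2.1,
      (memLp_two_iff_integrable_sq hi.2.2.1).2 hi2.2.2⟩
  · rintro ⟨h1, h2, h3⟩
    refine key.2 ⟨(integrable_μ_iff.2 ⟨h1.integrable one_le_two, h2.integrable one_le_two,
      h3.integrable one_le_two⟩).1, integrable_μ_iff.2 ⟨?_, ?_, ?_⟩⟩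
    · exact (memLp_two_iff_integrable_sq h1.1).1 h1
    · exact (memLp_two_iff_integrable_sq h2.1).1 h2
    · exact (memLp_two_iff_integrable_sq h3.1).1 h3

/-! ### Parameter integrals against product kernels -/

/-- Integration of `f` against a product kernel. -/
noncomputable def T (a b : ℝ → ℝ) (f : ℝ × ℝ → ℝ) : ℝ := ∫ q, a q.1 * b q.2 * f q ∂μ

/-- A measurable weight that is bounded on the support of `ν`. -/
structure IsWeight (a : ℝ → ℝ) : Prop where
  meas : Measurable a
  bdd : ∃ C, ∀ s ∈ Icc (-1 : ℝ) 1, |a s| ≤ C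

lemma IsWeight.memLp {a b : ℝ → ℝ} (ha : IsWeight a) (hb : IsWeight b) {p : ENNReal} :
    MemLp (fun q : ℝ × ℝ => a q.1 * b q.2) p μ := by
  obtain ⟨A, hA⟩ := ha.bdd
  obtain ⟨B, hB⟩ := hb.bdd
  refine MemLp.of_bound ((ha.meas.comp measurable_fst).mul
    (hb.meas.comp measurable_snd)).aestronglyMeasurable (A * B) ?_
  filter_upwards [ae_μ_mem] with q hq
  rw [Real.norm_eq_abs, abs_mul]
  exact mul_le_mul (hA _ hq.1) (hB _ hq.2) (abs_nonneg _) ((abs_nonneg _).trans (hA _ hq.1))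

lemma IsWeight.integrable_fst {a : ℝ → ℝ} (ha : IsWeight a) {f : ℝ × ℝ → ℝ}
    (hf : Integrable f μ) : Integrable (fun q => a q.1 * f q) μ := by
  obtain ⟨A, hA⟩ := ha.bdd
  refine hf.bdd_mul (c := A) (ha.meas.comp measurable_fst).aestronglyMeasurable ?_
  filter_upwards [ae_μ_mem] with q hq using hA _ hq.1

lemma IsWeight.integrable_snd {a : ℝ → ℝ} (ha : IsWeight a) {f : ℝ × ℝ → ℝ}
    (hf : Integrable f μ) : Integrable (fun q => a q.2 * f q) μ := by
  obtain ⟨A, hA⟩ := ha.bdd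
  refine hf.bdd_mul (c := A) (ha.meas.comp measurable_snd).aestronglyMeasurable ?_
  filter_upwards [ae_μ_mem] with q hq using hA _ hq.2

lemma IsWeight.integrable {a b : ℝ → ℝ} (ha : IsWeight a) (hb : IsWeight b) {f : ℝ × ℝ → ℝ}
    (hf : Integrable f μ) : Integrable (fun q => a q.1 * b q.2 * f q) μ := by
  simpa only [mul_assoc] using ha.integrable_fst (hb.integrable_snd hf)

lemma T_congr {a a' b b' : ℝ → ℝ} {f : ℝ × ℝ → ℝ} (ha : ∀ᵐ s ∂ν, a s = a' s)
    (hb : ∀ᵐ s ∂ν, b s = b' s) : T a b f = T a' b' f := by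
  refine integral_congr_ae ?_
  filter_upwards [quasi_fst.ae ha, quasi_snd.ae hb] with q h1 h2
  rw [h1, h2]

/-- A family of weights with a common bound for parameters near `[0,1]`. -/
structure IsKer (a : ℝ → ℝ → ℝ) : Prop where
  meas : ∀ x, Measurable (a x)
  bdd : ∃ C, ∀ x ∈ Icc (-1 : ℝ) 2, ∀ s ∈ Icc (-1 : ℝ) 1, |a x s| ≤ C
  cont : ∀ x ∈ I, ∀ᵐ s ∂ν, ContinuousAt (fun z => a z s) x

lemma mem_Icc_of_mem_I {x : ℝ} (hx : x ∈ I) : x ∈ Icc (-1 : ℝ) 2 :=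
  ⟨by linarith [hx.1], by linarith [hx.2]⟩

/-- Bounds on the larger interval [-1,2] make parameter derivatives two-sided even at the end points
of [0,1]. -/
lemma Icc_mem_nhds_of_mem_I {x : ℝ} (hx : x ∈ I) : Icc (-1 : ℝ) 2 ∈ nhds x :=
  Icc_mem_nhds (by linarith [hx.1]) (by linarith [hx.2])

lemma IsKer.isWeight {a : ℝ → ℝ → ℝ} (ha : IsKer a) {x : ℝ} (hx : x ∈ Icc (-1 : ℝ) 2) :
    IsWeight (a x) :=
  ⟨ha.meas x, ha.bdd.imp fun _ h => h x hx⟩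

/-- `a'` is the derivative of the kernel `a` with respect to its parameter, and `a` is Lipschitz
in the parameter. -/
structure IsKerDeriv (a a' : ℝ → ℝ → ℝ) : Prop where
  lip : ∃ C ≥ 0, ∀ s ∈ Icc (-1 : ℝ) 1, ∀ x ∈ Icc (-1 : ℝ) 2, ∀ z ∈ Icc (-1 : ℝ) 2,
    |a x s - a z s| ≤ C * |x - z|
  deriv : ∀ x ∈ I, ∀ᵐ s ∂ν, HasDerivAt (fun z => a z s) (a' x s) x

/-- Dominated differentiation with the Lipschitz bound C|c|. Since this bound is uniform,
differentiability of the kernel is needed only at the given x and for almost every s. -/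
lemma hasDerivAt_integral_ker {a a' : ℝ → ℝ → ℝ} (ha : IsKer a) (ha' : IsKer a')
    (h : IsKerDeriv a a') {π : ℝ × ℝ → ℝ} (hπ : Measure.QuasiMeasurePreserving π μ ν)
    {c : ℝ × ℝ → ℝ} (hc : Integrable c μ) {x : ℝ} (hx : x ∈ I) :
    HasDerivAt (fun z => ∫ q, a z (π q) * c q ∂μ) (∫ q, a' x (π q) * c q ∂μ) x := by
  obtain ⟨C, hC, hlip⟩ := h.lip
  obtain ⟨A, hA⟩ := (ha.isWeight (mem_Icc_of_mem_I hx)).bdd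
  have hmeas : ∀ {w : ℝ → ℝ}, Measurable w → AEStronglyMeasurable (fun q => w (π q) * c q) μ :=
    fun hw => (hw.comp hπ.measurable).aestronglyMeasurable.mul hc.1
  refine (hasDerivAt_integral_of_dominated_loc_of_lip (bound := fun q => C * |c q|)
    (Icc_mem_nhds_of_mem_I hx) (Filter.Eventually.of_forall fun z => hmeas (ha.meas z)) ?_
    (hmeas (ha'.meas x)) ?_ (hc.abs.const_mul C) ?_).2
  · refine hc.bdd_mul (c := A) ((ha.meas x).comp hπ.measurable).aestronglyMeasurable ?_
    filter_upwards [hπ.ae ae_ν_mem] with q hq using hA _ hq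
  · filter_upwards [hπ.ae ae_ν_mem] with q hq
    refine LipschitzOnWith.of_dist_le_mul fun y hy z hz => ?_
    have h1 := mul_le_mul_of_nonneg_right (hlip _ hq y hy z hz) (abs_nonneg (c q))
    rw [← abs_mul, sub_mul] at h1
    rw [Real.dist_eq, Real.dist_eq, Real.coe_nnabs, abs_of_nonneg (mul_nonneg hC (abs_nonneg _))]
    linarith
  · filter_upwards [hπ.ae (h.deriv x hx)] with q hq using hq.mul_const _

lemma hasDerivAt_T_fst {a a' : ℝ → ℝ → ℝ} (ha : IsKer a) (ha' : IsKer a') (h : IsKerDeriv a a')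
    {b : ℝ → ℝ} (hb : IsWeight b) {f : ℝ × ℝ → ℝ} (hf : Integrable f μ) {x : ℝ} (hx : x ∈ I) :
    HasDerivAt (fun z => T (a z) b f) (T (a' x) b f) x := by
  simpa only [T, mul_assoc] using hasDerivAt_integral_ker ha ha' h quasi_fst
    (hb.integrable_snd hf) hx

lemma hasDerivAt_T_snd {b b' : ℝ → ℝ → ℝ} (hb : IsKer b) (hb' : IsKer b') (h : IsKerDeriv b b')
    {a : ℝ → ℝ} (ha : IsWeight a) {f : ℝ × ℝ → ℝ} (hf : Integrable f μ) {x : ℝ} (hx : x ∈ I) :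
    HasDerivAt (fun z => T a (b z) f) (T a (b' x) f) x := by
  simpa only [T, mul_assoc, mul_left_comm] using hasDerivAt_integral_ker hb hb' h quasi_snd
    (ha.integrable_fst hf) hx

lemma continuousOn_T {a b : ℝ → ℝ → ℝ} (ha : IsKer a) (hb : IsKer b) {f : ℝ × ℝ → ℝ}
    (hf : Integrable f μ) : ContinuousOn (fun z : ℝ × ℝ => T (a z.1) (b z.2) f) D := by
  obtain ⟨A, hA⟩ := ha.bdd
  obtain ⟨B, hB⟩ := hb.bdd
  rintro ⟨x, t⟩ ⟨hx, ht⟩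
  refine continuousWithinAt_of_dominated (bound := fun q => A * B * |f q|) ?_ ?_
    (hf.abs.const_mul _) ?_
  · exact Filter.Eventually.of_forall fun z => (((ha.meas z.1).comp measurable_fst).mul
      ((hb.meas z.2).comp measurable_snd)).aestronglyMeasurable.mul hf.1
  · filter_upwards [self_mem_nhdsWithin] with z hz
    filter_upwards [ae_μ_mem] with q hq
    rw [Real.norm_eq_abs, abs_mul, abs_mul]
    have h1 := hA _ (mem_Icc_of_mem_I hz.1) _ hq.1
    have h2 := hB _ (mem_Icc_of_mem_I hz.2) _ hq.2
    exact mul_le_mul_of_nonneg_right (mul_le_mul h1 h2 (abs_nonneg _)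
      ((abs_nonneg _).trans h1)) (abs_nonneg _)
  · filter_upwards [quasi_fst.ae (ha.cont x hx), quasi_snd.ae (hb.cont t ht)] with q h1 h2
    have h1' : ContinuousAt (fun z : ℝ × ℝ => a z.1 q.1) (x, t) :=
      ContinuousAt.comp (g := fun z => a z q.1) (f := Prod.fst) h1 continuousAt_fst
    have h2' : ContinuousAt (fun z : ℝ × ℝ => b z.2 q.2) (x, t) :=
      ContinuousAt.comp (g := fun z => b z q.2) (f := Prod.snd) h2 continuousAt_snd
    exact ((h1'.mul h2').mul_const _).continuousWithinAt

/-! ### The concrete kernels -/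

/-- The kernel in the first variable: the quadratic vanishing at `0` and `1` for the atom, and the
Green function of the third derivative elsewhere. -/
noncomputable def Φ0 (x s : ℝ) : ℝ :=
  if s < 0 then x - x ^ 2 else max (x - s) 0 ^ 2 / 2 - x ^ 2 * (1 - s) ^ 2 / 2

/-- First derivative of `Φ0` in the parameter. -/
noncomputable def Φ1 (x s : ℝ) : ℝ :=
  if s < 0 then 1 - 2 * x else max (x - s) 0 - x * (1 - s) ^ 2

/-- Second derivative of `Φ0` in the parameter. -/
noncomputable def Φ2 (x s : ℝ) : ℝ :=
  if s < 0 then -2 else (if s ≤ x then 1 else 0) - (1 - s) ^ 2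

/-- The kernel in the second variable. -/
noncomputable def Ψ0 (t r : ℝ) : ℝ := if r < 0 then t else max (t - r) 0

/-- Derivative of `Ψ0` in the parameter. -/
noncomputable def Ψ1 (t r : ℝ) : ℝ := if r < 0 then 1 else if r ≤ t then 1 else 0

lemma continuousAt_ite_le {s x : ℝ} (h : s ≠ x) :
    ContinuousAt (fun z : ℝ => if s ≤ z then (1 : ℝ) else 0) x := by
  rcases h.lt_or_gt with h | h
  · refine (continuousAt_const (y := (1 : ℝ))).congr ?_
    filter_upwards [lt_mem_nhds h] with z hz
    rw [if_pos hz.le]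
  · refine (continuousAt_const (y := (0 : ℝ))).congr ?_
    filter_upwards [gt_mem_nhds h] with z hz
    rw [if_neg (not_le.2 hz)]

lemma hasDerivAt_max {s x : ℝ} (h : s ≠ x) :
    HasDerivAt (fun z : ℝ => max (z - s) 0) (if s ≤ x then 1 else 0) x := by
  rcases h.lt_or_gt with h | h
  · rw [if_pos h.le]
    refine ((hasDerivAt_id x).sub_const s).congr_of_eventuallyEq ?_
    filter_upwards [lt_mem_nhds h] with z hz
    rw [max_eq_left (by linarith)]; rfl
  · rw [if_neg (not_le.2 h)]
    refine (hasDerivAt_const x (0 : ℝ)).congr_of_eventuallyEq ?_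
    filter_upwards [gt_mem_nhds h] with z hz
    rw [max_eq_right (by linarith)]

lemma isKer_Φ0 : IsKer Φ0 where
  meas x := by
    unfold Φ0
    exact Measurable.ite measurableSet_Iio (by fun_prop) (by fun_prop)
  bdd := by
    refine ⟨20, fun x hx s hs => ?_⟩
    have h0 : 0 ≤ max (x - s) 0 := le_max_right _ _
    have h1 : max (x - s) 0 ≤ 3 := max_le (by linarith [hx.2, hs.1]) (by norm_num)
    unfold Φ0
    split_ifs with h
    · rw [abs_le]; constructor <;> nlinarith [hx.1, hx.2]
    · have h2 : 0 ≤ (1 - s) ^ 2 := sq_nonneg _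
      have h3 : (1 - s) ^ 2 ≤ 1 := by nlinarith [hs.2]
      have h4 : 0 ≤ x ^ 2 := sq_nonneg _
      have h5 : x ^ 2 ≤ 4 := by nlinarith [hx.1, hx.2]
      rw [abs_le]; constructor <;> nlinarith [mul_nonneg h4 h2, mul_le_mul h5 h3 h2 (by norm_num)]
  cont x _ := by
    refine Filter.Eventually.of_forall fun s => ?_
    unfold Φ0
    split_ifs <;> fun_prop

lemma isKer_Φ1 : IsKer Φ1 where
  meas x := by
    unfold Φ1
    exact Measurable.ite measurableSet_Iio (by fun_prop) (by fun_prop)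
  bdd := by
    refine ⟨20, fun x hx s hs => ?_⟩
    have h0 : 0 ≤ max (x - s) 0 := le_max_right _ _
    have h1 : max (x - s) 0 ≤ 3 := max_le (by linarith [hx.2, hs.1]) (by norm_num)
    unfold Φ1
    split_ifs with h
    · rw [abs_le]; constructor <;> linarith [hx.1, hx.2]
    · have h2 : 0 ≤ (1 - s) ^ 2 := sq_nonneg _
      have h3 : (1 - s) ^ 2 ≤ 1 := by nlinarith [hs.2]
      rw [abs_le]; constructor <;> nlinarith [hx.1, hx.2]
  cont x _ := by
    refine Filter.Eventually.of_forall fun s => ?_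
    unfold Φ1
    split_ifs <;> fun_prop

lemma isKer_Φ2 : IsKer Φ2 where
  meas x := by
    unfold Φ2
    exact Measurable.ite measurableSet_Iio (by fun_prop)
      ((Measurable.ite measurableSet_Iic (by fun_prop) (by fun_prop)).sub (by fun_prop))
  bdd := by
    refine ⟨20, fun x hx s hs => ?_⟩
    have h2 : 0 ≤ (1 - s) ^ 2 := sq_nonneg _
    have h3 : (1 - s) ^ 2 ≤ 4 := by nlinarith [hs.2, hs.1]
    unfold Φ2
    split_ifs <;> rw [abs_le] <;> constructor <;> linarith
  cont x hx := by
    filter_upwards [ae_ν_ne hx] with s hs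
    unfold Φ2
    split_ifs
    · fun_prop
    · exact (continuousAt_ite_le hs).sub continuousAt_const

lemma isKer_Ψ0 : IsKer Ψ0 where
  meas x := by
    unfold Ψ0
    exact Measurable.ite measurableSet_Iio (by fun_prop) (by fun_prop)
  bdd := by
    refine ⟨20, fun x hx s hs => ?_⟩
    have h0 : 0 ≤ max (x - s) 0 := le_max_right _ _
    have h1 : max (x - s) 0 ≤ 3 := max_le (by linarith [hx.2, hs.1]) (by norm_num)
    unfold Ψ0
    split_ifs with h <;> rw [abs_le] <;> constructor <;> linarith [hx.1, hx.2]
  cont x _ := by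
    refine Filter.Eventually.of_forall fun s => ?_
    unfold Ψ0
    split_ifs <;> fun_prop

lemma isKer_Ψ1 : IsKer Ψ1 where
  meas x := by
    unfold Ψ1
    exact Measurable.ite measurableSet_Iio (by fun_prop)
      (Measurable.ite measurableSet_Iic (by fun_prop) (by fun_prop))
  bdd := by
    refine ⟨20, fun x hx s hs => ?_⟩
    unfold Ψ1
    split_ifs <;> norm_num
  cont x hx := by
    filter_upwards [ae_ν_ne hx] with s hs
    unfold Ψ1
    split_ifs
    · fun_prop
    · exact continuousAt_ite_le hs

lemma abs_max_sub_max_le (x z s : ℝ) : |max (x - s) 0 - max (z - s) 0| ≤ |x - z| := by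
  simpa using abs_max_sub_max_le_abs (x - s) (z - s) 0

lemma isKerDeriv_Φ0 : IsKerDeriv Φ0 Φ1 where
  lip := by
    refine ⟨20, by norm_num, fun s hs x hx z hz => ?_⟩
    have hd := abs_max_sub_max_le x z s
    have hn := abs_nonneg (x - z)
    have hxz : |x + z| ≤ 4 := abs_le.2 ⟨by linarith [hx.1, hz.1], by linarith [hx.2, hz.2]⟩
    unfold Φ0
    split_ifs with h
    · have : x - x ^ 2 - (z - z ^ 2) = (1 - (x + z)) * (x - z) := by ring
      rw [this, abs_mul]
      refine mul_le_mul_of_nonneg_right ?_ hn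
      exact (abs_sub _ _).trans (by rw [abs_one]; linarith)
    · set p := max (x - s) 0
      set r := max (z - s) 0
      have hp0 : 0 ≤ p := le_max_right _ _
      have hp : p ≤ 3 := max_le (by linarith [hx.2, hs.1]) (by norm_num)
      have hr0 : 0 ≤ r := le_max_right _ _
      have hr : r ≤ 3 := max_le (by linarith [hz.2, hs.1]) (by norm_num)
      have h2 : 0 ≤ (1 - s) ^ 2 := sq_nonneg _
      have h3 : (1 - s) ^ 2 ≤ 1 := by nlinarith [hs.2]
      have : p ^ 2 / 2 - x ^ 2 * (1 - s) ^ 2 / 2 - (r ^ 2 / 2 - z ^ 2 * (1 - s) ^ 2 / 2)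
          = (p + r) / 2 * (p - r) - (1 - s) ^ 2 / 2 * (x + z) * (x - z) := by ring
      rw [this]
      refine (abs_sub _ _).trans ?_
      rw [abs_mul, abs_mul _ (x - z), abs_mul, abs_of_nonneg (by positivity : 0 ≤ (p + r) / 2),
        abs_of_nonneg (by positivity : 0 ≤ (1 - s) ^ 2 / 2)]
      have e1 : (p + r) / 2 * |p - r| ≤ 3 * |x - z| :=
        mul_le_mul (by linarith) hd (abs_nonneg _) (by norm_num)
      have e2 : (1 - s) ^ 2 / 2 * |x + z| ≤ 1 * 4 :=
        mul_le_mul (by linarith) hxz (abs_nonneg _) (by norm_num)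
      have e3 := mul_le_mul_of_nonneg_right e2 hn
      linarith
  deriv x hx := by
    filter_upwards [ae_ν_ne hx] with s hs
    unfold Φ0 Φ1
    split_ifs with h
    · refine ((hasDerivAt_id x).sub (hasDerivAt_pow 2 x)).congr_deriv ?_
      simp
    · refine ((((hasDerivAt_max hs).pow 2).div_const 2).sub
        (((hasDerivAt_pow 2 x).mul_const ((1 - s) ^ 2)).div_const 2)).congr_deriv ?_
      split_ifs with h'
      · norm_num; ring
      · rw [max_eq_right (by linarith)]; norm_num; ring

lemma isKerDeriv_Φ1 : IsKerDeriv Φ1 Φ2 where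
  lip := by
    refine ⟨20, by norm_num, fun s hs x hx z hz => ?_⟩
    have hd := abs_max_sub_max_le x z s
    have hn := abs_nonneg (x - z)
    unfold Φ1
    split_ifs with h
    · have : 1 - 2 * x - (1 - 2 * z) = -2 * (x - z) := by ring
      rw [this, abs_mul]
      exact mul_le_mul_of_nonneg_right (by norm_num) hn
    · have h2 : 0 ≤ (1 - s) ^ 2 := sq_nonneg _
      have h3 : (1 - s) ^ 2 ≤ 1 := by nlinarith [hs.2]
      have : max (x - s) 0 - x * (1 - s) ^ 2 - (max (z - s) 0 - z * (1 - s) ^ 2)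
          = (max (x - s) 0 - max (z - s) 0) - (1 - s) ^ 2 * (x - z) := by ring
      rw [this]
      refine (abs_sub _ _).trans ?_
      rw [abs_mul, abs_of_nonneg h2]
      have := mul_le_mul_of_nonneg_right h3 hn
      linarith
  deriv x hx := by
    filter_upwards [ae_ν_ne hx] with s hs
    unfold Φ1 Φ2
    split_ifs with h h'
    · refine (((hasDerivAt_id x).const_mul 2).const_sub 1).congr_deriv ?_
      norm_num
    all_goals
      refine ((hasDerivAt_max hs).sub ((hasDerivAt_id x).mul_const ((1 - s) ^ 2))).congr_deriv ?_
      simp [h']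

lemma isKerDeriv_Ψ0 : IsKerDeriv Ψ0 Ψ1 where
  lip := by
    refine ⟨1, by norm_num, fun s hs x hx z hz => ?_⟩
    have hd := abs_max_sub_max_le x z s
    unfold Ψ0
    split_ifs with h <;> linarith
  deriv x hx := by
    filter_upwards [ae_ν_ne hx] with s hs
    unfold Ψ0 Ψ1
    by_cases h : s < 0
    · simp only [if_pos h]; exact hasDerivAt_id x
    · simp only [if_neg h]; exact hasDerivAt_max hs

lemma Φ0_zero : ∀ᵐ s ∂ν, Φ0 0 s = 0 := by
  filter_upwards [ae_ν_ne_zero] with s hs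
  unfold Φ0
  split_ifs with h
  · ring
  · rw [max_eq_right (by linarith)]; ring

lemma Φ0_one : ∀ᵐ s ∂ν, Φ0 1 s = 0 := by
  filter_upwards [ae_ν_mem] with s hs
  unfold Φ0
  split_ifs with h
  · ring
  · rw [max_eq_left (by linarith [hs.2])]; ring

lemma Ψ0_zero : ∀ᵐ s ∂ν, Ψ0 0 s = 0 := by
  filter_upwards [ae_ν_ne_zero] with s hs
  unfold Ψ0
  split_ifs with h
  · rfl
  · rw [max_eq_right (by linarith)]

lemma Φ1_zero : ∀ᵐ s ∂ν, Φ1 0 s = if s < 0 then 1 else 0 := by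
  filter_upwards [ae_ν_ne_zero] with s hs
  unfold Φ1
  split_ifs with h
  · ring
  · rw [max_eq_right (by linarith)]; ring

/-! ### Functions represented by a density -/

/-- The function on the square represented by the density `f`. -/
noncomputable def Y (f : ℝ × ℝ → ℝ) (ξ η : ℝ) : ℝ := T (Φ0 ξ) (Ψ0 η) f

/-- Derivatives fall on the kernels. Allowing any y that agrees with `Y f` on the square lets these
formulas be iterated and applied to arbitrary representatives. -/
lemma EqOnD.dt_Y {f : ℝ × ℝ → ℝ} (hf : Integrable f μ) {y : ℝ → ℝ → ℝ} (h : EqOnD y (Y f)) :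
    EqOnD (dt y) (fun ξ η => T (Φ0 ξ) (Ψ1 η) f) :=
  h.dt_eq fun _ hξ _ hη => hasDerivAt_T_snd isKer_Ψ0 isKer_Ψ1 isKerDeriv_Ψ0
    (isKer_Φ0.isWeight (mem_Icc_of_mem_I hξ)) hf hη

lemma EqOnD.dx_Y {f : ℝ × ℝ → ℝ} (hf : Integrable f μ) {y : ℝ → ℝ → ℝ} (h : EqOnD y (Y f)) :
    EqOnD (dx y) (fun ξ η => T (Φ1 ξ) (Ψ0 η) f) :=
  h.dx_eq fun _ hξ _ hη => hasDerivAt_T_fst isKer_Φ0 isKer_Φ1 isKerDeriv_Φ0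
    (isKer_Ψ0.isWeight (mem_Icc_of_mem_I hη)) hf hξ

lemma EqOnD.dx_dx_Y {f : ℝ × ℝ → ℝ} (hf : Integrable f μ) {y : ℝ → ℝ → ℝ} (h : EqOnD y (Y f)) :
    EqOnD (dx (dx y)) (fun ξ η => T (Φ2 ξ) (Ψ0 η) f) :=
  (h.dx_Y hf).dx_eq fun _ hξ _ hη => hasDerivAt_T_fst isKer_Φ1 isKer_Φ2 isKerDeriv_Φ1
    (isKer_Ψ0.isWeight (mem_Icc_of_mem_I hη)) hf hξ

lemma EqOnD.dt_dx_Y {f : ℝ × ℝ → ℝ} (hf : Integrable f μ) {y : ℝ → ℝ → ℝ} (h : EqOnD y (Y f)) :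
    EqOnD (dt (dx y)) (fun ξ η => T (Φ1 ξ) (Ψ1 η) f) :=
  (h.dx_Y hf).dt_eq fun _ hξ _ hη => hasDerivAt_T_snd isKer_Ψ0 isKer_Ψ1 isKerDeriv_Ψ0
    (isKer_Φ1.isWeight (mem_Icc_of_mem_I hξ)) hf hη

lemma EqOnD.dx_dt_Y {f : ℝ × ℝ → ℝ} (hf : Integrable f μ) {y : ℝ → ℝ → ℝ} (h : EqOnD y (Y f)) :
    EqOnD (dx (dt y)) (fun ξ η => T (Φ1 ξ) (Ψ1 η) f) :=
  (h.dt_Y hf).dx_eq fun _ hξ _ hη => hasDerivAt_T_fst isKer_Φ0 isKer_Φ1 isKerDeriv_Φ0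
    (isKer_Ψ1.isWeight (mem_Icc_of_mem_I hη)) hf hξ

lemma EqOnD.d21_Y {f : ℝ × ℝ → ℝ} (hf : Integrable f μ) {y : ℝ → ℝ → ℝ} (h : EqOnD y (Y f)) :
    EqOnD (d21 y) (fun ξ η => T (Φ2 ξ) (Ψ1 η) f) :=
  (h.dx_dt_Y hf).dx_eq fun _ hξ _ hη => hasDerivAt_T_fst isKer_Φ1 isKer_Φ2 isKerDeriv_Φ1
    (isKer_Ψ1.isWeight (mem_Icc_of_mem_I hη)) hf hξ

lemma EqOnD.differentiable_Y {f : ℝ × ℝ → ℝ} (hf : Integrable f μ) {y : ℝ → ℝ → ℝ}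
    (h : EqOnD y (Y f)) {ξ η : ℝ} (hξ : ξ ∈ I) (hη : η ∈ I) :
    DifferentiableWithinAt ℝ (fun r => y ξ r) I η ∧
      DifferentiableWithinAt ℝ (fun s => dt y s η) I ξ ∧
      DifferentiableWithinAt ℝ (fun s => dx (dt y) s η) I ξ :=
  ⟨(h.hasDerivWithinAt_snd (fun _ hξ _ hη => hasDerivAt_T_snd isKer_Ψ0 isKer_Ψ1 isKerDeriv_Ψ0
      (isKer_Φ0.isWeight (mem_Icc_of_mem_I hξ)) hf hη) hξ hη).differentiableWithinAt,
    ((h.dt_Y hf).hasDerivWithinAt_fst (fun _ hξ _ hη => hasDerivAt_T_fst isKer_Φ0 isKer_Φ1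
      isKerDeriv_Φ0 (isKer_Ψ1.isWeight (mem_Icc_of_mem_I hη)) hf hξ)
      hξ hη).differentiableWithinAt,
    ((h.dx_dt_Y hf).hasDerivWithinAt_fst (fun _ hξ _ hη => hasDerivAt_T_fst isKer_Φ1 isKer_Φ2
      isKerDeriv_Φ1 (isKer_Ψ1.isWeight (mem_Icc_of_mem_I hη)) hf hξ)
      hξ hη).differentiableWithinAt⟩

lemma T_zero_left {a b : ℝ → ℝ} (ha : ∀ᵐ s ∂ν, a s = 0) (f : ℝ × ℝ → ℝ) : T a b f = 0 := by
  rw [T_congr (a' := fun _ => 0) (b' := b) ha (Filter.Eventually.of_forall fun _ => rfl)]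
  simp [T]

lemma T_zero_right {a b : ℝ → ℝ} (hb : ∀ᵐ s ∂ν, b s = 0) (f : ℝ × ℝ → ℝ) : T a b f = 0 := by
  rw [T_congr (a' := a) (b' := fun _ => 0) (Filter.Eventually.of_forall fun _ => rfl) hb]
  simp [T]

lemma Y_left (f : ℝ × ℝ → ℝ) (η : ℝ) : Y f 0 η = 0 := T_zero_left Φ0_zero f

lemma Y_right (f : ℝ × ℝ → ℝ) (η : ℝ) : Y f 1 η = 0 := T_zero_left Φ0_one f

lemma Y_initial (f : ℝ × ℝ → ℝ) (ξ : ℝ) : Y f ξ 0 = 0 := T_zero_right Ψ0_zero f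

lemma setIntegral_eq_of_indicator {α : Type*} [MeasurableSpace α] {m : Measure α} {B S : Set α}
    (hB : MeasurableSet B) (hS : MeasurableSet S) (hSB : S ⊆ B) {F g : α → ℝ}
    (h : ∀ q ∈ B, F q = S.indicator g q) : ∫ q in B, F q ∂m = ∫ q in S, g q ∂m := by
  rw [setIntegral_congr_fun hB h, setIntegral_indicator hS, inter_eq_self_of_subset_right hSB]

lemma isWeight_sq : IsWeight (fun s => (1 - s) ^ 2) where
  meas := by fun_prop
  bdd := ⟨4, fun s hs => by rw [abs_of_nonneg (sq_nonneg _)]; nlinarith [hs.1, hs.2]⟩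

/-- The density in the second variable of the trace at `ξ = 0` of `∂³y/∂ξ²∂η`. -/
noncomputable def traceDensity (f : ℝ × ℝ → ℝ) (r : ℝ) : ℝ :=
  -2 * f (-1, r) - ∫ s in I, (1 - s) ^ 2 * f (s, r)

lemma integrableOn_prod_swap_slice {f : ℝ × ℝ → ℝ} (hf : IntegrableOn f D) :
    IntegrableOn (fun r => ∫ s in I, f (s, r)) I := by
  have : Integrable f ((volume.restrict I).prod (volume.restrict I)) := by
    rw [← volume_restrict_D]; exact hf
  exact this.integral_prod_right

lemma setIntegral_rect_swap {f : ℝ × ℝ → ℝ} (hf : IntegrableOn f D) {η : ℝ} (hη : η ∈ I) :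
    ∫ q in I ×ˢ Icc 0 η, f q = ∫ r in Icc 0 η, ∫ s in I, f (s, r) := by
  have h1 : IntegrableOn f (I ×ˢ Icc 0 η) := hf.mono_set (prod_mono le_rfl (Icc_zero_subset_I hη))
  have h2 : Integrable f ((volume.restrict I).prod (volume.restrict (Icc 0 η))) := by
    rw [Measure.prod_restrict]; exact h1
  rw [← integral_prod_symm _ h2, Measure.prod_restrict]
  rfl

lemma integrableOn_traceDensity {f : ℝ × ℝ → ℝ} (hf : Integrable f μ) :
    IntegrableOn (traceDensity f) I :=
  ((integrable_μ_iff.1 hf).2.1.const_mul _).sub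
    (integrableOn_prod_swap_slice (integrable_μ_iff.1 (isWeight_sq.integrable_fst hf)).2.2)

/-- `∂³y/∂ξ²∂η` as an indefinite integral. -/
lemma T_Φ2_Ψ1 {f : ℝ × ℝ → ℝ} (hf : Integrable f μ) {ξ η : ℝ} (hξ : ξ ∈ I) (hη : η ∈ I) :
    T (Φ2 ξ) (Ψ1 η) f = traceDensity f (-1) + (∫ s in Icc 0 ξ, f (s, -1))
      + (∫ r in Icc 0 η, traceDensity f r) + ∫ q in Icc 0 ξ ×ˢ Icc 0 η, f q := by
  obtain ⟨h1, h2, h3⟩ := integrable_μ_iff.1 hf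
  obtain ⟨g1, -, g3⟩ := integrable_μ_iff.1 (isWeight_sq.integrable_fst hf)
  have hIξ := Icc_zero_subset_I hξ
  have hIη := Icc_zero_subset_I hη
  rw [T, integral_μ ((isKer_Φ2.isWeight (mem_Icc_of_mem_I hξ)).integrable
    (isKer_Ψ1.isWeight (mem_Icc_of_mem_I hη)) hf)]
  -- The pieces of `μ` are evaluated one by one. The indicators in `Φ2` and `Ψ1` cut the domains to
  -- [0,ξ] and [0,η]; the terms -2 and -(1-s)², which do not involve ξ, regroup into `traceDensity`.
  have e1 : Φ2 ξ (-1) * Ψ1 η (-1) * f (-1, -1) = -2 * f (-1, -1) := by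
    norm_num [Φ2, Ψ1]
  have e2 : ∫ s in I, Φ2 ξ s * Ψ1 η (-1) * f (s, -1)
      = (∫ s in Icc 0 ξ, f (s, -1)) - ∫ s in I, (1 - s) ^ 2 * f (s, -1) := by
    rw [← setIntegral_eq_of_indicator (B := I) measurableSet_Icc measurableSet_Icc hIξ
      (F := (Icc 0 ξ).indicator fun s => f (s, -1)) (fun q _ => rfl), ← integral_sub _ g1]
    · refine setIntegral_congr_fun measurableSet_Icc fun s hs => ?_
      by_cases h : s ≤ ξ
      · simp [Φ2, Ψ1, hs.1, hs.1.not_gt, h]; ring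
      · simp [Φ2, Ψ1, hs.1.not_gt, h]
    · exact h1.indicator measurableSet_Icc
  have e3 : ∫ r in I, Φ2 ξ (-1) * Ψ1 η r * f (-1, r) = ∫ r in Icc 0 η, -2 * f (-1, r) := by
    refine setIntegral_eq_of_indicator measurableSet_Icc measurableSet_Icc hIη fun r hr => ?_
    by_cases h : r ≤ η
    · simp [Φ2, Ψ1, hr.1, hr.1.not_gt, h]
    · simp [Φ2, Ψ1, hr.1.not_gt, h]
  have e4 : ∫ q in D, Φ2 ξ q.1 * Ψ1 η q.2 * f q = (∫ q in Icc 0 ξ ×ˢ Icc 0 η, f q)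
      - ∫ r in Icc 0 η, ∫ s in I, (1 - s) ^ 2 * f (s, r) := by
    have hD : MeasurableSet D := measurableSet_Icc.prod measurableSet_Icc
    have hS1 : MeasurableSet (Icc 0 ξ ×ˢ Icc 0 η) := measurableSet_Icc.prod measurableSet_Icc
    have hS2 : MeasurableSet (I ×ˢ Icc 0 η) := measurableSet_Icc.prod measurableSet_Icc
    rw [← setIntegral_rect_swap g3 hη,
      ← setIntegral_eq_of_indicator (B := D) hD hS1 (prod_mono hIξ hIη)
      (F := (Icc 0 ξ ×ˢ Icc 0 η).indicator f) (fun q _ => rfl),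
      ← setIntegral_eq_of_indicator (B := D) hD hS2 (prod_mono le_rfl hIη)
      (F := (I ×ˢ Icc 0 η).indicator fun q => (1 - q.1) ^ 2 * f q) (fun q _ => rfl),
      ← integral_sub (h3.indicator hS1) (g3.indicator hS2)]
    refine setIntegral_congr_fun hD ?_
    rintro ⟨s, r⟩ ⟨hs, hr⟩
    have hs0 : 0 ≤ s := hs.1
    have hs1 : s ≤ 1 := hs.2
    have hr0 : 0 ≤ r := hr.1
    by_cases h : s ≤ ξ <;> by_cases h' : r ≤ η
    · simp [indicator, Φ2, Ψ1, hs0, hs1, hr0, hs0.not_gt, hr0.not_gt, h, h']; ring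
    all_goals simp [indicator, Φ2, Ψ1, hs0, hs1, hr0, hs0.not_gt, hr0.not_gt, h, h']
  have e5 : ∫ r in Icc 0 η, traceDensity f r = (∫ r in Icc 0 η, -2 * f (-1, r))
      - ∫ r in Icc 0 η, ∫ s in I, (1 - s) ^ 2 * f (s, r) :=
    integral_sub ((h2.mono_set hIη).const_mul _)
      ((integrableOn_prod_swap_slice g3).mono_set hIη)
  rw [e1, e2, e3, e4, e5, traceDensity]
  ring

/-- At ξ = 0 the kernel `Φ1` lives only on the atom, so the trace of y_ξη on the left edge sees only
f(-1,·). -/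
lemma T_Φ1_zero_Ψ1 {f : ℝ × ℝ → ℝ} (hf : Integrable f μ) {η : ℝ} (hη : η ∈ I) :
    T (Φ1 0) (Ψ1 η) f = f (-1, -1) + ∫ r in Icc 0 η, f (-1, r) := by
  have hw : IsWeight (fun s : ℝ => if s < 0 then (1 : ℝ) else 0) :=
    ⟨Measurable.ite measurableSet_Iio (by fun_prop) (by fun_prop),
      ⟨1, fun s _ => by split_ifs <;> norm_num⟩⟩
  rw [T_congr Φ1_zero (Filter.Eventually.of_forall fun _ => rfl), T,
    integral_μ (hw.integrable (isKer_Ψ1.isWeight (mem_Icc_of_mem_I hη)) hf)]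
  have e2 : ∫ s in I, (if s < 0 then (1 : ℝ) else 0) * Ψ1 η (-1) * f (s, -1) = 0 :=
    setIntegral_eq_zero_of_forall_eq_zero fun s hs => by simp [hs.1.not_gt]
  have e4 : ∫ q in D, (if q.1 < 0 then (1 : ℝ) else 0) * Ψ1 η q.2 * f q = 0 :=
    setIntegral_eq_zero_of_forall_eq_zero fun q hq => by simp [hq.1.1.not_gt]
  have e3 : ∫ r in I, (if (-1 : ℝ) < 0 then (1 : ℝ) else 0) * Ψ1 η r * f (-1, r)
      = ∫ r in Icc 0 η, f (-1, r) := by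
    refine setIntegral_eq_of_indicator measurableSet_Icc measurableSet_Icc
      (Icc_zero_subset_I hη) fun r hr => ?_
    by_cases h : r ≤ η
    · simp [Ψ1, hr.1, hr.1.not_gt, h]
    · simp [Ψ1, hr.1.not_gt, h]
  rw [e2, e3, e4]
  norm_num [Ψ1]

lemma integral_Icc_self_zero (g : ℝ → ℝ) : ∫ s in Icc (0 : ℝ) 0, g s = 0 := by simp

lemma setIntegral_rect_zero_left (g : ℝ × ℝ → ℝ) (η : ℝ) :
    ∫ q in Icc (0 : ℝ) 0 ×ˢ Icc 0 η, g q = 0 := by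
  have : volume (Icc (0 : ℝ) 0 ×ˢ Icc 0 η) = 0 := by
    rw [Measure.volume_eq_prod, Measure.prod_prod]; simp
  rw [Measure.restrict_eq_zero.2 this, integral_zero_measure]

lemma setIntegral_rect_zero_right (g : ℝ × ℝ → ℝ) (ξ : ℝ) :
    ∫ q in Icc (0 : ℝ) ξ ×ˢ Icc (0 : ℝ) 0, g q = 0 := by
  have : volume (Icc (0 : ℝ) ξ ×ˢ Icc (0 : ℝ) 0) = 0 := by
    rw [Measure.volume_eq_prod, Measure.prod_prod]; simp
  rw [Measure.restrict_eq_zero.2 this, integral_zero_measure]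

/-- On the edge η = 0 the formula `T_Φ2_Ψ1` reduces to a primitive of f(·,-1), which Lebesgue
differentiation recovers. -/
lemma EqOnD.edge_x_Y {f : ℝ × ℝ → ℝ} (hf : Integrable f μ) {y : ℝ → ℝ → ℝ} (h : EqOnD y (Y f)) :
    (fun ξ => dx (dx (dx (dt y))) ξ 0) =ᵐ[volume.restrict I] fun s => f (s, -1) := by
  refine dI_primitive_ae (u := fun ξ => d21 y ξ 0) (c := traceDensity f (-1))
    (integrable_μ_iff.1 hf).1 fun x hx => ?_
  rw [h.d21_Y hf x hx 0 zero_mem_I]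
  beta_reduce
  rw [T_Φ2_Ψ1 hf hx zero_mem_I, setIntegral_rect_zero_right,
    integral_Icc_self_zero]
  ring

lemma EqOnD.edge_t_Y {f : ℝ × ℝ → ℝ} (hf : Integrable f μ) {y : ℝ → ℝ → ℝ} (h : EqOnD y (Y f)) :
    (fun η => dt (dt (dx y)) 0 η) =ᵐ[volume.restrict I] fun r => f (-1, r) := by
  refine dI_primitive_ae (u := fun η => dt (dx y) 0 η) (c := f (-1, -1))
    (integrable_μ_iff.1 hf).2.1 fun x hx => ?_
  rw [h.dt_dx_Y hf 0 zero_mem_I x hx]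
  beta_reduce
  rw [T_Φ1_zero_Ψ1 hf hx]

lemma EqOnD.corner_Y {f : ℝ × ℝ → ℝ} (hf : Integrable f μ) {y : ℝ → ℝ → ℝ} (h : EqOnD y (Y f)) :
    dx (dt y) 0 0 = f (-1, -1) := by
  rw [h.dx_dt_Y hf 0 zero_mem_I 0 zero_mem_I]
  beta_reduce
  rw [T_Φ1_zero_Ψ1 hf zero_mem_I, integral_Icc_self_zero,
    add_zero]

/-- Rectangular increments cancel the constant and the two one-variable terms of `T_Φ2_Ψ1`. -/
lemma EqOnD.isMixedDeriv_Y {f : ℝ × ℝ → ℝ} (hf : MemLp f 2 μ) {y : ℝ → ℝ → ℝ}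
    (h : EqOnD y (Y f)) : IsMixedDeriv (d21 y) f := by
  have hf1 := hf.integrable one_le_two
  refine ⟨(memLp_μ_iff.1 hf).2.2, fun ξ hξ η hη => ?_⟩
  have hd := h.d21_Y hf1
  rw [hd ξ hξ η hη, hd 0 zero_mem_I η hη, hd ξ hξ 0 zero_mem_I, hd 0 zero_mem_I 0 zero_mem_I]
  beta_reduce
  rw [T_Φ2_Ψ1 hf1 hξ hη, T_Φ2_Ψ1 hf1 zero_mem_I hη, T_Φ2_Ψ1 hf1 hξ zero_mem_I,
    T_Φ2_Ψ1 hf1 zero_mem_I zero_mem_I]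
  simp only [setIntegral_rect_zero_left, setIntegral_rect_zero_right, integral_Icc_self_zero]
  ring

/-- Functions represented by a square integrable density belong to the space. -/
lemma EqOnD.memW32 {f : ℝ × ℝ → ℝ} (hf : MemLp f 2 μ) {y : ℝ → ℝ → ℝ} (h : EqOnD y (Y f)) :
    MemW32 y := by
  have hf1 := hf.integrable one_le_two
  obtain ⟨m1, m2, m3⟩ := memLp_μ_iff.1 hf
  obtain ⟨i1, i2, i3⟩ := integrable_μ_iff.1 hf1
  have hd := h.d21_Y hf1
  exact {
    diff_t := fun ξ hξ η hη => (h.differentiable_Y hf1 hξ hη).1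
    diff_xt := fun ξ hξ η hη => (h.differentiable_Y hf1 hξ hη).2.1
    diff_xxt := fun ξ hξ η hη => (h.differentiable_Y hf1 hξ hη).2.2
    absCont := by
      refine ⟨fun s => f (s, -1), traceDensity f, f, i1, integrableOn_traceDensity hf1, i3,
        fun ξ hξ η hη => ?_⟩
      rw [hd ξ hξ η hη, hd 0 zero_mem_I 0 zero_mem_I]
      beta_reduce
      rw [T_Φ2_Ψ1 hf1 hξ hη,
        T_Φ2_Ψ1 hf1 zero_mem_I zero_mem_I]
      simp only [setIntegral_rect_zero_left, integral_Icc_self_zero]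
      ring
    mixed := ⟨f, h.isMixedDeriv_Y hf⟩
    edge_x := (memLp_congr_ae (h.edge_x_Y hf1)).2 m1
    edge_t := (memLp_congr_ae (h.edge_t_Y hf1)).2 m2
    initial := fun ξ hξ => by rw [h ξ hξ 0 zero_mem_I, Y_initial]
    left := fun η hη => by rw [h 0 zero_mem_I η hη, Y_left]
    right := fun η hη => by rw [h 1 one_mem_I η hη, Y_right] }

/-! ### The inner product in terms of densities -/

/-- This makes the choice in `d32` immaterial under integrals. -/
lemma IsMixedDeriv.ae_eq {w : ℝ → ℝ → ℝ} {k k' : ℝ × ℝ → ℝ} (h : IsMixedDeriv w k)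
    (h' : IsMixedDeriv w k') : k =ᵐ[volume.restrict D] k' := by
  have hk : IntegrableOn k D := h.1.integrable one_le_two
  have hk' : IntegrableOn k' D := h'.1.integrable one_le_two
  have := ae_eq_zero_of_rectangle_integral_eq_zero (hk.sub hk') fun ξ hξ η hη => by
    have hs : Icc 0 ξ ×ˢ Icc 0 η ⊆ D := prod_mono (Icc_zero_subset_I hξ) (Icc_zero_subset_I hη)
    simp only [Pi.sub_apply]
    rw [integral_sub (hk.mono_set hs) (hk'.mono_set hs), ← h.2 ξ hξ η hη, ← h'.2 ξ hξ η hη,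
      sub_self]
  filter_upwards [this] with q hq
  exact sub_eq_zero.1 hq

lemma isMixedDeriv_d32 {y : ℝ → ℝ → ℝ} (h : ∃ k, IsMixedDeriv (d21 y) k) :
    IsMixedDeriv (d21 y) (d32 y) := by
  rw [d32, dif_pos h]
  exact h.choose_spec

/-- The inner product of the space is that of the densities. -/
lemma inner32_Y {f g : ℝ × ℝ → ℝ} (hf : MemLp f 2 μ) (hg : MemLp g 2 μ) {y v : ℝ → ℝ → ℝ}
    (hy : EqOnD y (Y f)) (hv : EqOnD v (Y g)) : inner32 y v = ∫ q, f q * g q ∂μ := by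
  have hf1 := hf.integrable one_le_two
  have hg1 := hg.integrable one_le_two
  have my := hy.memW32 hf
  have hfg : Integrable (fun q => f q * g q) μ := hf.integrable_mul hg
  -- The boundary conditions on y alone kill every term except one per piece of `μ`.
  have dtl : ∀ η ∈ I, dt y 0 η = 0 := dI_eq_zero my.left
  have dtr : ∀ η ∈ I, dt y 1 η = 0 := dI_eq_zero my.right
  have ddl : ∀ η ∈ I, dt (dt y) 0 η = 0 := dI_eq_zero dtl
  have ddr : ∀ η ∈ I, dt (dt y) 1 η = 0 := dI_eq_zero dtr
  have d1 := dI_eq_zero my.initial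
  have d3 := dI_eq_zero (dI_eq_zero d1)
  have t1 : ∫ η in I, dt (dt y) 0 η * dt (dt v) 0 η = 0 :=
    setIntegral_eq_zero_of_forall_eq_zero fun η hη => by rw [ddl η hη, zero_mul]
  have t3 : ∫ η in I, dt (dt y) 1 η * dt (dt v) 1 η = 0 :=
    setIntegral_eq_zero_of_forall_eq_zero fun η hη => by rw [ddr η hη, zero_mul]
  have t2 : ∫ η in I, dt (dt (dx y)) 0 η * dt (dt (dx v)) 0 η = ∫ r in I, f (-1, r) * g (-1, r) :=
    integral_congr_ae ((hy.edge_t_Y hf1).mul (hv.edge_t_Y hg1))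
  have t4 : inner3 (fun ξ => y ξ 0) (fun ξ => v ξ 0) = 0 := by
    rw [inner3, my.initial 0 zero_mem_I, my.initial 1 one_mem_I, d1 0 zero_mem_I,
      setIntegral_eq_zero_of_forall_eq_zero fun s hs => by rw [d3 s hs, zero_mul]]
    ring
  have t5 : inner3 (fun ξ => dt y ξ 0) (fun ξ => dt v ξ 0)
      = f (-1, -1) * g (-1, -1) + ∫ s in I, f (s, -1) * g (s, -1) := by
    rw [inner3, dtl 0 zero_mem_I, dtr 0 zero_mem_I, ← hy.corner_Y hf1, ← hv.corner_Y hg1,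
      zero_mul, zero_mul, zero_add, add_zero]
    exact congrArg₂ (· + ·) rfl
      (integral_congr_ae ((hy.edge_x_Y hf1).mul (hv.edge_x_Y hg1)))
  have t6 : ∫ q in D, d32 y q * d32 v q = ∫ q in D, f q * g q :=
    integral_congr_ae (((isMixedDeriv_d32 my.mixed).ae_eq (hy.isMixedDeriv_Y hf)).mul
      ((isMixedDeriv_d32 (hv.memW32 hg).mixed).ae_eq (hv.isMixedDeriv_Y hg)))
  rw [inner32, t1, t2, t3, t4, t5, t6, integral_μ hfg]
  ring

/-! ### Existence of a density -/

lemma eq_of_hasDerivWithinAt_zero {u : ℝ → ℝ} (h : ∀ x ∈ I, HasDerivWithinAt u 0 I x) :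
    ∀ x ∈ I, u x = u 0 :=
  constant_of_derivWithin_zero (fun x hx => (h x hx).differentiableWithinAt) fun x hx =>
    (h x (Ico_subset_Icc_self hx)).derivWithin (uniqueDiffWithinAt_I (Ico_subset_Icc_self hx))

/-- Existence of `∂³y/∂ξ²∂η` together with the boundary conditions. -/
structure IsRegular (y : ℝ → ℝ → ℝ) : Prop where
  diff_t : ∀ ξ ∈ I, ∀ η ∈ I, DifferentiableWithinAt ℝ (fun r => y ξ r) I η
  diff_xt : ∀ ξ ∈ I, ∀ η ∈ I, DifferentiableWithinAt ℝ (fun s => dt y s η) I ξ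
  diff_xxt : ∀ ξ ∈ I, ∀ η ∈ I, DifferentiableWithinAt ℝ (fun s => dx (dt y) s η) I ξ
  initial : ∀ ξ ∈ I, y ξ 0 = 0
  left : ∀ η ∈ I, y 0 η = 0
  right : ∀ η ∈ I, y 1 η = 0

lemma MemW32.isRegular {y : ℝ → ℝ → ℝ} (h : MemW32 y) : IsRegular y :=
  ⟨h.diff_t, h.diff_xt, h.diff_xxt, h.initial, h.left, h.right⟩

/-- Integrability suffices, so this applies before the density is known to be square integrable. -/
lemma isRegular_Y {f : ℝ × ℝ → ℝ} (hf : Integrable f μ) : IsRegular (Y f) where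
  diff_t _ hξ _ hη := (EqOnD.differentiable_Y hf (fun _ _ _ _ => rfl) hξ hη).1
  diff_xt _ hξ _ hη := (EqOnD.differentiable_Y hf (fun _ _ _ _ => rfl) hξ hη).2.1
  diff_xxt _ hξ _ hη := (EqOnD.differentiable_Y hf (fun _ _ _ _ => rfl) hξ hη).2.2
  initial ξ _ := Y_initial f ξ
  left η _ := Y_left f η
  right η _ := Y_right f η

/-- A function satisfying the boundary conditions is determined by `∂³y/∂ξ²∂η`. -/
lemma IsRegular.eqOnD {y v : ℝ → ℝ → ℝ} (hy : IsRegular y) (hv : IsRegular v)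
    (h : EqOnD (d21 y) (d21 v)) : EqOnD y v := by
  have hdt : EqOnD (dt y) (dt v) := by
    intro ξ hξ η hη
    -- The difference of the η-derivatives is affine in ξ with slope c; it vanishes at 0 and 1, so c
    -- = 0.
    set c := dx (dt y) 0 η - dx (dt v) 0 η with hc
    have h1 : ∀ s ∈ I, dx (dt y) s η - dx (dt v) s η = c :=
      eq_of_hasDerivWithinAt_zero (u := fun s => dx (dt y) s η - dx (dt v) s η) fun s hs =>
        ((hy.diff_xxt s hs η hη).hasDerivWithinAt.sub
          (hv.diff_xxt s hs η hη).hasDerivWithinAt).congr_deriv (sub_eq_zero.2 (h s hs η hη))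
    have h2 := eq_of_hasDerivWithinAt_zero (u := fun s => dt y s η - dt v s η - c * s) fun s hs =>
      (((hy.diff_xt s hs η hη).hasDerivWithinAt.sub
          (hv.diff_xt s hs η hη).hasDerivWithinAt).sub
          ((hasDerivWithinAt_id s I).const_mul c)).congr_deriv
        (by rw [mul_one]; exact sub_eq_zero.2 (h1 s hs))
    have l1 : dt y 0 η = 0 := dI_eq_zero hy.left η hη
    have l2 : dt v 0 η = 0 := dI_eq_zero hv.left η hη
    have r1 : dt y 1 η = 0 := dI_eq_zero hy.right η hη
    have r2 : dt v 1 η = 0 := dI_eq_zero hv.right η hη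
    have h3 := h2 1 one_mem_I
    have h4 := h2 ξ hξ
    simp only [l1, l2, r1, r2] at h3 h4
    have hc0 : c = 0 := by linarith
    rw [hc0] at h4
    linarith
  intro ξ hξ η hη
  have h1 := eq_of_hasDerivWithinAt_zero (u := fun r => y ξ r - v ξ r) (fun r hr =>
    ((hy.diff_t ξ hξ r hr).hasDerivWithinAt.sub
      (hv.diff_t ξ hξ r hr).hasDerivWithinAt).congr_deriv (sub_eq_zero.2 (hdt ξ hξ r hr))) η hη
  simp only [hy.initial ξ hξ, hv.initial ξ hξ, sub_zero] at h1
  linarith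

/-- Every function of the space is represented by a square integrable density. -/
lemma MemW32.exists_density {y : ℝ → ℝ → ℝ} (hy : MemW32 y) :
    ∃ f, MemLp f 2 μ ∧ EqOnD y (Y f) := by
  obtain ⟨g, h, k₀, hg, hh, -, hw⟩ := hy.absCont
  obtain ⟨k, hk2, hk⟩ := hy.mixed
  have hk1 : IntegrableOn k D := hk2.integrable one_le_two
  have hksq : IntegrableOn (fun q => (1 - q.1) ^ 2 * k q) D :=
    hk1.continuousOn_mul (by fun_prop) (isCompact_Icc.prod isCompact_Icc)
  -- The values c and A solve `traceDensity f (-1) = d21 y 0 0` and `traceDensity f = h`. At this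
  -- stage A is only integrable.
  set c : ℝ := -(d21 y 0 0 + ∫ s in I, (1 - s) ^ 2 * g s) / 2 with hc
  set A : ℝ → ℝ := fun r => -(1 / 2) * (h r + ∫ s in I, (1 - s) ^ 2 * k (s, r)) with hA
  have hAint : IntegrableOn A I := (hh.add (integrableOn_prod_swap_slice hksq)).const_mul _
  set f : ℝ × ℝ → ℝ := fun q =>
    if q.1 < 0 then (if q.2 < 0 then c else A q.2) else if q.2 < 0 then g q.1 else k q with hf
  have fc : f (-1, -1) = c := by norm_num [hf]
  have fg : ∀ s ∈ I, f (s, -1) = g s := fun s hs => by simp [hf, hs.1.not_gt]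
  have fA : ∀ r ∈ I, f (-1, r) = A r := fun r hr => by simp [hf, hr.1.not_gt]
  have fk : ∀ q ∈ D, f q = k q := fun q hq => by
    simp only [hf, if_neg hq.1.1.not_gt, if_neg hq.2.1.not_gt]
  have hD : MeasurableSet D := measurableSet_Icc.prod measurableSet_Icc
  have hf1 : Integrable f μ := integrable_μ_iff.2
    ⟨(integrableOn_congr_fun fg measurableSet_Icc).2 hg,
      (integrableOn_congr_fun fA measurableSet_Icc).2 hAint, (integrableOn_congr_fun fk hD).2 hk1⟩
  have tr0 : traceDensity f (-1) = d21 y 0 0 := by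
    have e : ∫ s in I, (1 - s) ^ 2 * f (s, -1) = ∫ s in I, (1 - s) ^ 2 * g s :=
      setIntegral_congr_fun measurableSet_Icc fun s hs => by simp only [fg s hs]
    rw [traceDensity, fc, hc, e]
    ring
  have tr : ∀ r ∈ I, traceDensity f r = h r := fun r hr => by
    have e : ∫ s in I, (1 - s) ^ 2 * f (s, r) = ∫ s in I, (1 - s) ^ 2 * k (s, r) :=
      setIntegral_congr_fun measurableSet_Icc fun s hs => by simp only [fk (s, r) ⟨hs, hr⟩]
    rw [traceDensity, fA r hr, hA, e]
    ring
  have hd : EqOnD (d21 y) (d21 (Y f)) := by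
    intro ξ hξ η hη
    rw [EqOnD.d21_Y hf1 (fun _ _ _ _ => rfl) ξ hξ η hη]
    beta_reduce
    -- The Carathéodory formula is used only on the two axes; the rectangular increment comes from
    -- the `L²` density k.
    have e1 := hw ξ hξ 0 zero_mem_I
    have e2 := hw 0 zero_mem_I η hη
    rw [setIntegral_rect_zero_right, integral_Icc_self_zero] at e1
    rw [setIntegral_rect_zero_left, integral_Icc_self_zero] at e2
    rw [T_Φ2_Ψ1 hf1 hξ hη, tr0,
      setIntegral_congr_fun measurableSet_Icc fun s hs => fg s (Icc_zero_subset_I hξ hs),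
      setIntegral_congr_fun measurableSet_Icc fun r hr => tr r (Icc_zero_subset_I hη hr),
      setIntegral_congr_fun (measurableSet_Icc.prod measurableSet_Icc) fun q hq =>
        fk q ⟨Icc_zero_subset_I hξ hq.1, Icc_zero_subset_I hη hq.2⟩, ← hk ξ hξ η hη, e1, e2]
    ring
  have hyf : EqOnD y (Y f) := hy.isRegular.eqOnD (isRegular_Y hf1) hd
  -- Once y is represented, the edge parts of f agree almost everywhere with the edge derivatives,
  -- which are square integrable by hypothesis.
  refine ⟨f, memLp_μ_iff.2 ⟨?_, ?_, ?_⟩, hyf⟩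
  · exact (memLp_congr_ae (hyf.edge_x_Y hf1)).1 hy.edge_x
  · exact (memLp_congr_ae (hyf.edge_t_Y hf1)).1 hy.edge_t
  · exact (memLp_congr_ae (by
      filter_upwards [ae_restrict_mem hD] with q hq using fk q hq)).2 hk2

/-! ### The kernel as a Gram integral -/

lemma integral_ν {F : ℝ → ℝ} (hF : IntegrableOn F I) :
    ∫ s, F s ∂ν = F (-1) + ∫ s in I, F s := by
  rw [ν, integral_add_measure (integrable_dirac (by simp)) hF, integral_dirac]

/-- The integrand lives on [0,a]; writing b-s = (a-s) + (b-a) gives an antiderivative in powers of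
a-s. -/
lemma integral_max_mul_max {a b : ℝ} (ha : a ∈ I) (hab : a ≤ b) :
    ∫ s in I, max (a - s) 0 * max (b - s) 0 = a ^ 3 / 3 + (b - a) * a ^ 2 / 2 := by
  rw [setIntegral_eq_of_indicator measurableSet_Icc measurableSet_Icc (Icc_zero_subset_I ha)
    (g := fun s => (a - s) * (b - s)), integral_Icc_eq_integral_Ioc,
    ← intervalIntegral.integral_of_le ha.1,
    intervalIntegral.integral_eq_sub_of_hasDerivAt
      (f := fun s => -((a - s) ^ 3 / 3 + (b - a) * (a - s) ^ 2 / 2))]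
  · ring
  · intro s _
    have h := (hasDerivAt_id s).const_sub a
    refine (((h.pow 3).div_const 3).add
      (((h.pow 2).const_mul (b - a)).div_const 2)).neg.congr_deriv ?_
    norm_num; ring
  · exact Continuous.intervalIntegrable (by fun_prop) _ _
  · intro s hs
    by_cases h : s ≤ a
    · rw [indicator_of_mem (mem_Icc.2 ⟨hs.1, h⟩), max_eq_left (by linarith),
        max_eq_left (by linarith)]
    · rw [indicator_of_notMem fun h' => h h'.2, max_eq_right (by linarith), zero_mul]

lemma integral_max_sq_mul_max_sq {a b : ℝ} (ha : a ∈ I) (hab : a ≤ b) :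
    ∫ s in I, max (a - s) 0 ^ 2 * max (b - s) 0 ^ 2
      = a ^ 5 / 5 + (b - a) * a ^ 4 / 2 + (b - a) ^ 2 * a ^ 3 / 3 := by
  rw [setIntegral_eq_of_indicator measurableSet_Icc measurableSet_Icc (Icc_zero_subset_I ha)
    (g := fun s => (a - s) ^ 2 * (b - s) ^ 2), integral_Icc_eq_integral_Ioc,
    ← intervalIntegral.integral_of_le ha.1,
    intervalIntegral.integral_eq_sub_of_hasDerivAt
      (f := fun s => -((a - s) ^ 5 / 5 + (b - a) * (a - s) ^ 4 / 2
        + (b - a) ^ 2 * (a - s) ^ 3 / 3))]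
  · ring
  · intro s _
    have h := (hasDerivAt_id s).const_sub a
    refine ((((h.pow 5).div_const 5).add
      (((h.pow 4).const_mul (b - a)).div_const 2)).add
        (((h.pow 3).const_mul ((b - a) ^ 2)).div_const 3)).neg.congr_deriv ?_
    norm_num; ring
  · exact Continuous.intervalIntegrable (by fun_prop) _ _
  · intro s hs
    by_cases h : s ≤ a
    · rw [indicator_of_mem (mem_Icc.2 ⟨hs.1, h⟩), max_eq_left (by linarith),
        max_eq_left (by linarith)]
    · rw [indicator_of_notMem fun h' => h h'.2, max_eq_right (by linarith)]
      ring

lemma integral_Ψ0_mul_Ψ0 {t η : ℝ} (hη : η ∈ I) (h : η ≤ t) :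
    ∫ r, Ψ0 η r * Ψ0 t r ∂ν = η * t + 1 / 2 * t * η ^ 2 - 1 / 6 * η ^ 3 := by
  have e : ∀ r ∈ I, Ψ0 η r * Ψ0 t r = max (η - r) 0 * max (t - r) 0 := fun r hr => by
    simp [Ψ0, hr.1.not_gt]
  rw [integral_ν, setIntegral_congr_fun measurableSet_Icc e, integral_max_mul_max hη h]
  · norm_num [Ψ0]; ring
  · exact (integrableOn_congr_fun e measurableSet_Icc).2
      (Continuous.integrableOn_Icc (by fun_prop))

lemma integral_Φ0_mul_Φ0 {x ξ : ℝ} (hx : x ∈ I) (hξ : ξ ∈ I) (h : ξ ≤ x) :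
    ∫ s, Φ0 ξ s * Φ0 x s ∂ν = -1 / 120 * (x - 1) * ξ * (ξ * x ^ 4 - 4 * ξ * x ^ 3
      + 6 * ξ * x ^ 2 + x * ξ ^ 4 - 5 * x * ξ ^ 3 - 120 * x * ξ + 120 * x + ξ ^ 4) := by
  -- Writing 1-s as a positive part makes all four terms of the expansion instances of the same
  -- integral.
  have e : ∀ s ∈ I, Φ0 ξ s * Φ0 x s = 1 / 4 * (max (ξ - s) 0 ^ 2 * max (x - s) 0 ^ 2)
      - x ^ 2 / 4 * (max (ξ - s) 0 ^ 2 * max (1 - s) 0 ^ 2)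
      - ξ ^ 2 / 4 * (max (x - s) 0 ^ 2 * max (1 - s) 0 ^ 2)
      + x ^ 2 * ξ ^ 2 / 4 * (max (1 - s) 0 ^ 2 * max (1 - s) 0 ^ 2) := fun s hs => by
    rw [max_eq_left (sub_nonneg.2 hs.2)]
    simp only [Φ0, if_neg hs.1.not_gt]
    ring
  have hi : ∀ c a b : ℝ,
      IntegrableOn (fun s => c * (max (a - s) 0 ^ 2 * max (b - s) 0 ^ 2)) I :=
    fun c a b => Continuous.integrableOn_Icc (by fun_prop)
  have hlin : ∀ {u v w z : ℝ → ℝ}, IntegrableOn u I → IntegrableOn v I → IntegrableOn w I →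
      IntegrableOn z I →
      ∫ s in I, (u s - v s - w s + z s) = (∫ s in I, u s) - (∫ s in I, v s)
        - (∫ s in I, w s) + ∫ s in I, z s := by
    intro u v w z hu hv hw hz
    have h1 : IntegrableOn (fun s => u s - v s) I := hu.sub hv
    have h2 : IntegrableOn (fun s => u s - v s - w s) I := h1.sub hw
    rw [integral_add h2 hz, integral_sub h1 hw, integral_sub hu hv]
  rw [integral_ν, setIntegral_congr_fun measurableSet_Icc e,
    hlin (hi (1 / 4) ξ x) (hi (x ^ 2 / 4) ξ 1) (hi (ξ ^ 2 / 4) x 1) (hi (x ^ 2 * ξ ^ 2 / 4) 1 1),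
    integral_const_mul, integral_const_mul, integral_const_mul, integral_const_mul,
    integral_max_sq_mul_max_sq hξ h, integral_max_sq_mul_max_sq hξ hξ.2,
    integral_max_sq_mul_max_sq hx hx.2, integral_max_sq_mul_max_sq one_mem_I le_rfl]
  · norm_num [Φ0]; ring
  · exact (integrableOn_congr_fun e measurableSet_Icc).2
      (((((hi _ _ _).sub (hi _ _ _)).sub (hi _ _ _)).add (hi _ _ _)))

lemma R2_eq {t η : ℝ} (ht : t ∈ I) (hη : η ∈ I) : R2 t η = ∫ r, Ψ0 η r * Ψ0 t r ∂ν := by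
  unfold R2
  split_ifs with h
  · rw [integral_Ψ0_mul_Ψ0 hη h]
  · simp_rw [mul_comm (Ψ0 η _)]
    rw [integral_Ψ0_mul_Ψ0 ht (not_le.1 h).le]
    ring

lemma R3_eq {x ξ : ℝ} (hx : x ∈ I) (hξ : ξ ∈ I) : R3 x ξ = ∫ s, Φ0 ξ s * Φ0 x s ∂ν := by
  unfold R3
  split_ifs with h
  · rw [integral_Φ0_mul_Φ0 hx hξ h]
  · simp_rw [mul_comm (Φ0 ξ _)]
    rw [integral_Φ0_mul_Φ0 hξ hx (not_le.1 h).le]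

/-- The density of a product of two weights. -/
noncomputable def tens (a b : ℝ → ℝ) (q : ℝ × ℝ) : ℝ := a q.1 * b q.2

/-- By Fubini the product of the two Gram integrals is one integral over `μ`: the density of the
kernel at (x,t) is the weight that evaluates at (x,t). -/
lemma K32_eq {x t ξ η : ℝ} (hx : x ∈ I) (ht : t ∈ I) (hξ : ξ ∈ I) (hη : η ∈ I) :
    K32 x t ξ η = Y (tens (Φ0 x) (Ψ0 t)) ξ η := by
  rw [K32, R3_eq hx hξ, R2_eq ht hη, ← integral_prod_mul, Y, T, μ]
  refine integral_congr_ae (Filter.Eventually.of_forall fun q => ?_)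
  simp only [tens]
  ring

lemma memLp_tens {a b : ℝ → ℝ} (ha : IsWeight a) (hb : IsWeight b) : MemLp (tens a b) 2 μ :=
  ha.memLp hb

lemma memLp_tens_Φ0_Ψ0 {x t : ℝ} (hx : x ∈ I) (ht : t ∈ I) :
    MemLp (tens (Φ0 x) (Ψ0 t)) 2 μ :=
  memLp_tens (isKer_Φ0.isWeight (mem_Icc_of_mem_I hx)) (isKer_Ψ0.isWeight (mem_Icc_of_mem_I ht))

lemma isReproducingKernel32_K32 : IsReproducingKernel32 K32 := by
  intro x hx t ht
  have hK : EqOnD (K32 x t) (Y (tens (Φ0 x) (Ψ0 t))) := fun ξ hξ η hη => K32_eq hx ht hξ hη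
  have hL2 := memLp_tens_Φ0_Ψ0 hx ht
  refine ⟨hK.memW32 hL2, fun y hy => ?_⟩
  obtain ⟨f, hf, hyf⟩ := hy.exists_density
  rw [inner32_Y hf hL2 hyf hK, hyf x hx t ht, Y, T]
  exact integral_congr_ae (Filter.Eventually.of_forall fun q => mul_comm _ _)

/-! ### The Caputo derivative on densities -/

lemma measurable_Ψ1_uncurry : Measurable (fun p : ℝ × ℝ => Ψ1 p.1 p.2) := by
  unfold Ψ1
  exact Measurable.ite (measurableSet_lt measurable_snd measurable_const) measurable_const
    (Measurable.ite (measurableSet_le measurable_snd measurable_fst) measurable_const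
      measurable_const)

lemma abs_Ψ1_le (x s : ℝ) : |Ψ1 x s| ≤ 1 := by
  unfold Ψ1
  split_ifs <;> norm_num

/-- The Caputo derivative (up to the factor `1 / Γ(1 - α)`) of the kernel `Ψ0`. -/
noncomputable def Ψα (α t r : ℝ) : ℝ := max (t - max r 0) 0 ^ (1 - α) / (1 - α)

lemma isKer_Ψα {α : ℝ} (hα : α < 1) : IsKer (Ψα α) where
  meas x := by
    unfold Ψα
    fun_prop
  bdd := by
    refine ⟨3 ^ (1 - α) / (1 - α), fun x hx s hs => ?_⟩
    have h1 : 0 < 1 - α := by linarith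
    have h0 : 0 ≤ max (x - max s 0) 0 := le_max_right _ _
    unfold Ψα
    rw [abs_of_nonneg (div_nonneg (Real.rpow_nonneg h0 _) h1.le)]
    refine div_le_div_of_nonneg_right (Real.rpow_le_rpow h0 ?_ h1.le) h1.le
    exact max_le (by linarith [hx.2, le_max_right s 0]) (by norm_num)
  cont x _ := by
    refine Filter.Eventually.of_forall fun s => ?_
    unfold Ψα
    refine (Continuous.div_const (Continuous.rpow_const (by fun_prop) fun z => Or.inr ?_)
      _).continuousAt
    linarith

lemma intervalIntegrable_sub_rpow {α : ℝ} (hα : α < 1) (η a b : ℝ) :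
    IntervalIntegrable (fun ρ => (η - ρ) ^ (-α)) volume a b := by
  have h : IntervalIntegrable (fun u : ℝ => u ^ (-α)) volume (η - a) (η - b) :=
    intervalIntegral.intervalIntegrable_rpow' (by linarith)
  simpa using h.comp_sub_left η

/-- On [0,η] the function ρ ↦ `Ψ1 ρ r` is the indicator of ρ ≥ max(r,0), so the atom r = -1 behaves
like r = 0. -/
lemma integral_Ψ1_mul_rpow {α : ℝ} (hα : α < 1) {η : ℝ} (r : ℝ) :
    ∫ ρ in Icc 0 η, Ψ1 ρ r * (η - ρ) ^ (-α) = Ψα α η r := by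
  have hα' : 1 - α ≠ 0 := by linarith
  have hΨ : ∀ ρ ∈ Icc 0 η, Ψ1 ρ r * (η - ρ) ^ (-α)
      = (Icc (max r 0) η).indicator (fun ρ => (η - ρ) ^ (-α)) ρ := by
    intro ρ hρ
    by_cases h : max r 0 ≤ ρ
    · rw [indicator_of_mem (mem_Icc.2 ⟨h, hρ.2⟩)]
      have : r ≤ ρ := (le_max_left _ _).trans h
      simp [Ψ1, this]
    · rw [indicator_of_notMem fun h' => h h'.1]
      have : ρ < r := by
        by_contra h'
        exact h (max_le (not_lt.1 h') hρ.1)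
      simp [Ψ1, this, (hρ.1.trans_lt this).not_gt]
  rw [setIntegral_eq_of_indicator measurableSet_Icc measurableSet_Icc
    (Icc_subset_Icc_left (le_max_right r 0)) hΨ, Ψα]
  rcases le_or_gt (max r 0) η with h | h
  · rw [integral_Icc_eq_integral_Ioc, ← intervalIntegral.integral_of_le h,
      intervalIntegral.integral_comp_sub_left (fun u => u ^ (-α)) η, sub_self,
      integral_rpow (Or.inl (by linarith)), max_eq_left (sub_nonneg.2 h), neg_add_eq_sub,
      Real.zero_rpow hα', sub_zero]
  · rw [Icc_eq_empty (not_le.2 h), setIntegral_empty, max_eq_right (by linarith),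
      Real.zero_rpow hα', zero_div]

/-- Fubini applies because `Ψ1` is bounded and the singularity is integrable for α < 1. -/
lemma integral_T_Ψ1_mul_rpow {α : ℝ} (hα : α < 1) {f : ℝ × ℝ → ℝ} (hf : Integrable f μ)
    {a : ℝ → ℝ} (ha : IsWeight a) {η : ℝ} (hη : η ∈ I) :
    ∫ ρ in Icc 0 η, T a (Ψ1 ρ) f * (η - ρ) ^ (-α) = T a (Ψα α η) f := by
  have h1 : IntegrableOn (fun ρ => (η - ρ) ^ (-α)) (Icc 0 η) :=
    (intervalIntegrable_iff_integrableOn_Icc_of_le hη.1).1 (intervalIntegrable_sub_rpow hα η 0 η)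
  have h2 := ha.integrable_fst hf
  have h3 : Integrable (fun p : ℝ × ℝ × ℝ =>
      Ψ1 p.1 p.2.2 * ((η - p.1) ^ (-α) * (a p.2.1 * f p.2)))
      ((volume.restrict (Icc 0 η)).prod μ) := by
    refine (h1.mul_prod h2).bdd_mul (c := 1) ?_ (Filter.Eventually.of_forall fun p => abs_Ψ1_le _ _)
    exact (measurable_Ψ1_uncurry.comp
      (measurable_fst.prodMk (measurable_snd.comp measurable_snd))).aestronglyMeasurable
  have h4 := integral_integral_swap (f := fun ρ q => Ψ1 ρ q.2 * ((η - ρ) ^ (-α) * (a q.1 * f q))) h3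
  have e1 : ∀ ρ, ∫ q, Ψ1 ρ q.2 * ((η - ρ) ^ (-α) * (a q.1 * f q)) ∂μ
      = T a (Ψ1 ρ) f * (η - ρ) ^ (-α) := fun ρ => by
    rw [T, ← integral_mul_const]
    exact integral_congr_ae (Filter.Eventually.of_forall fun q => by ring)
  have e2 : ∀ q : ℝ × ℝ, ∫ ρ in Icc 0 η, Ψ1 ρ q.2 * ((η - ρ) ^ (-α) * (a q.1 * f q))
      = a q.1 * Ψα α η q.2 * f q := fun q => by
    simp_rw [← mul_assoc (Ψ1 _ _)]
    rw [integral_mul_const, integral_Ψ1_mul_rpow hα]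
    ring
  simp_rw [e1, e2] at h4
  exact h4

/-- The Caputo derivative acts on densities through a kernel. -/
lemma exists_ker_caputo {α : ℝ} (hα1 : α ≤ 1) :
    ∃ b, IsKer b ∧ ∀ f, Integrable f μ → ∀ y, EqOnD y (Y f) →
      EqOnD (caputo α y) (fun ξ η => T (Φ0 ξ) (b η) f) := by
  rcases hα1.eq_or_lt with rfl | hα
  · refine ⟨Ψ1, isKer_Ψ1, fun f hf y hy ξ hξ η hη => ?_⟩
    rw [caputo, if_pos rfl, hy.dt_Y hf ξ hξ η hη]
  · have hk := isKer_Ψα hα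
    refine ⟨fun t r => 1 / Real.Gamma (1 - α) * Ψα α t r, ⟨fun x => (hk.meas x).const_mul _, ?_,
      fun x hx => (hk.cont x hx).mono fun s hs => hs.const_mul _⟩, fun f hf y hy ξ hξ η hη => ?_⟩
    · obtain ⟨C, hC⟩ := hk.bdd
      refine ⟨|1 / Real.Gamma (1 - α)| * C, fun x hx s hs => ?_⟩
      rw [abs_mul]
      exact mul_le_mul_of_nonneg_left (hC x hx s hs) (abs_nonneg _)
    · beta_reduce
      rw [caputo, if_neg hα.ne]
      have e : ∀ r ∈ Icc 0 η, dt y ξ r / (η - r) ^ α = T (Φ0 ξ) (Ψ1 r) f * (η - r) ^ (-α) := by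
        intro r hr
        rw [hy.dt_Y hf ξ hξ r (Icc_zero_subset_I hη hr), Real.rpow_neg (sub_nonneg.2 hr.2),
          div_eq_mul_inv]
      rw [setIntegral_congr_fun measurableSet_Icc e,
        integral_T_Ψ1_mul_rpow hα hf (isKer_Φ0.isWeight (mem_Icc_of_mem_I hξ)) hη, T, T,
        ← integral_const_mul]
      exact integral_congr_ae (Filter.Eventually.of_forall fun q => by ring)

/-! ### The operator as a family of functionals -/

/-- The density representing the functional `y ↦ L y (z)`, given the kernel `b` of the Caputo
derivative. -/
noncomputable def evalL (b : ℝ → ℝ → ℝ) (k₁ k₂ k₃ : ℝ → ℝ → ℝ) (z q : ℝ × ℝ) : ℝ :=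
  tens (Φ0 z.1) (b z.2) q + k₁ z.1 z.2 * tens (Φ2 z.1) (Ψ0 z.2) q
    + k₂ z.1 z.2 * tens (Φ0 z.1) (Ψ0 z.2) q + k₃ z.1 z.2 * tens (Φ1 z.1) (Ψ0 z.2) q

lemma integral_add_four {u v w z : ℝ × ℝ → ℝ} (hu : Integrable u μ) (hv : Integrable v μ)
    (hw : Integrable w μ) (hz : Integrable z μ) : ∫ q, (u q + v q + w q + z q) ∂μ
      = (∫ q, u q ∂μ) + (∫ q, v q ∂μ) + (∫ q, w q ∂μ) + ∫ q, z q ∂μ := by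
  have h1 : Integrable (fun q => u q + v q) μ := hu.add hv
  have h2 : Integrable (fun q => u q + v q + w q) μ := h1.add hw
  rw [integral_add h2 hz, integral_add h1 hw, integral_add hu hv]

section Operator

variable {b : ℝ → ℝ → ℝ} {k₁ k₂ k₃ : ℝ → ℝ → ℝ}

lemma memLp_evalL (hb : IsKer b) (k₁ k₂ k₃ : ℝ → ℝ → ℝ) {z : ℝ × ℝ} (hz : z ∈ D) :
    MemLp (evalL b k₁ k₂ k₃ z) 2 μ := by
  have h1 := mem_Icc_of_mem_I hz.1
  have h2 := mem_Icc_of_mem_I hz.2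
  have hΨ := isKer_Ψ0.isWeight h2
  exact (((memLp_tens (isKer_Φ0.isWeight h1) (hb.isWeight h2)).add
    ((memLp_tens (isKer_Φ2.isWeight h1) hΨ).const_mul _)).add
    ((memLp_tens (isKer_Φ0.isWeight h1) hΨ).const_mul _)).add
    ((memLp_tens (isKer_Φ1.isWeight h1) hΨ).const_mul _)

lemma opL_eq_T {α : ℝ} (hcap : ∀ f, Integrable f μ → ∀ y, EqOnD y (Y f) →
      EqOnD (caputo α y) (fun ξ η => T (Φ0 ξ) (b η) f)) {f : ℝ × ℝ → ℝ} (hf : Integrable f μ)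
    {y : ℝ → ℝ → ℝ} (hy : EqOnD y (Y f)) {z : ℝ × ℝ} (hz : z ∈ D) :
    opL α k₁ k₂ k₃ y z.1 z.2 = T (Φ0 z.1) (b z.2) f + k₁ z.1 z.2 * T (Φ2 z.1) (Ψ0 z.2) f
      + k₂ z.1 z.2 * T (Φ0 z.1) (Ψ0 z.2) f + k₃ z.1 z.2 * T (Φ1 z.1) (Ψ0 z.2) f := by
  rw [opL, hcap f hf y hy _ hz.1 _ hz.2, hy.dx_dx_Y hf _ hz.1 _ hz.2, hy _ hz.1 _ hz.2,
    hy.dx_Y hf _ hz.1 _ hz.2, Y]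

lemma opL_eq_integral (hb : IsKer b) {α : ℝ} (hcap : ∀ f, Integrable f μ → ∀ y, EqOnD y (Y f) →
      EqOnD (caputo α y) (fun ξ η => T (Φ0 ξ) (b η) f)) {f : ℝ × ℝ → ℝ} (hf : Integrable f μ)
    {y : ℝ → ℝ → ℝ} (hy : EqOnD y (Y f)) {z : ℝ × ℝ} (hz : z ∈ D) :
    opL α k₁ k₂ k₃ y z.1 z.2 = ∫ q, evalL b k₁ k₂ k₃ z q * f q ∂μ := by
  have h1 := mem_Icc_of_mem_I hz.1
  have h2 := mem_Icc_of_mem_I hz.2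
  have hΨ := isKer_Ψ0.isWeight h2
  have i1 := (isKer_Φ0.isWeight h1).integrable (hb.isWeight h2) hf
  have i2 := ((isKer_Φ2.isWeight h1).integrable hΨ hf).const_mul (k₁ z.1 z.2)
  have i3 := ((isKer_Φ0.isWeight h1).integrable hΨ hf).const_mul (k₂ z.1 z.2)
  have i4 := ((isKer_Φ1.isWeight h1).integrable hΨ hf).const_mul (k₃ z.1 z.2)
  have e : ∀ q, evalL b k₁ k₂ k₃ z q * f q = Φ0 z.1 q.1 * b z.2 q.2 * f q
      + k₁ z.1 z.2 * (Φ2 z.1 q.1 * Ψ0 z.2 q.2 * f q)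
      + k₂ z.1 z.2 * (Φ0 z.1 q.1 * Ψ0 z.2 q.2 * f q)
      + k₃ z.1 z.2 * (Φ1 z.1 q.1 * Ψ0 z.2 q.2 * f q) := fun q => by
    simp only [evalL, tens]
    ring
  simp_rw [e]
  rw [opL_eq_T hcap hf hy hz, integral_add_four i1 i2 i3 i4, integral_const_mul,
    integral_const_mul, integral_const_mul]
  rfl

lemma continuousOn_opL (hb : IsKer b) {α : ℝ} (hcap : ∀ f, Integrable f μ → ∀ y, EqOnD y (Y f) →
      EqOnD (caputo α y) (fun ξ η => T (Φ0 ξ) (b η) f))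
    (hk₁ : ContinuousOn (Function.uncurry k₁) D) (hk₂ : ContinuousOn (Function.uncurry k₂) D)
    (hk₃ : ContinuousOn (Function.uncurry k₃) D) {f : ℝ × ℝ → ℝ} (hf : Integrable f μ)
    {y : ℝ → ℝ → ℝ} (hy : EqOnD y (Y f)) :
    ContinuousOn (fun z : ℝ × ℝ => opL α k₁ k₂ k₃ y z.1 z.2) D :=
  (((((continuousOn_T isKer_Φ0 hb hf).add (hk₁.mul (continuousOn_T isKer_Φ2 isKer_Ψ0 hf))).add
    (hk₂.mul (continuousOn_T isKer_Φ0 isKer_Ψ0 hf))).add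
    (hk₃.mul (continuousOn_T isKer_Φ1 isKer_Ψ0 hf)))).congr fun _ hz => opL_eq_T hcap hf hy hz

/-- `L` applied to the kernel is represented by the density of the evaluation functional. -/
lemma eqOnD_psi (hb : IsKer b) {α : ℝ} (hcap : ∀ f, Integrable f μ → ∀ y, EqOnD y (Y f) →
      EqOnD (caputo α y) (fun ξ η => T (Φ0 ξ) (b η) f)) {p : ℕ → ℝ × ℝ} (hp : ∀ i, p i ∈ D)
    (i : ℕ) : EqOnD (psi (opL α k₁ k₂ k₃) p i) (Y (evalL b k₁ k₂ k₃ (p i))) := by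
  intro ξ hξ η hη
  -- K is symmetric: as a function of (x,t) it has density `Φ0 ξ` ⊗ `Ψ0 η`. Pairing this with
  -- `evalL` is evaluating `Y` of `evalL` at (ξ,η).
  have hK : EqOnD (fun x t => K32 x t ξ η) (Y (tens (Φ0 ξ) (Ψ0 η))) := fun x hx t ht => by
    beta_reduce
    rw [K32_eq hx ht hξ hη, Y, Y, T, T]
    refine integral_congr_ae (Filter.Eventually.of_forall fun q => ?_)
    simp only [tens]
    ring
  rw [psi, opL_eq_integral hb hcap ((memLp_tens_Φ0_Ψ0 hξ hη).integrable one_le_two) hK (hp i), Y, T]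
  refine integral_congr_ae (Filter.Eventually.of_forall fun q => ?_)
  simp only [tens]
  ring

end Operator

/-! ### Completeness through the Hilbert space -/

lemma Y_zero (ξ η : ℝ) : Y 0 ξ η = 0 := by simp [Y, T]

lemma inner_toLp {f g : ℝ × ℝ → ℝ} (hf : MemLp f 2 μ) (hg : MemLp g 2 μ) :
    inner ℝ (hf.toLp f) (hg.toLp g) = ∫ q, f q * g q ∂μ := by
  rw [L2.inner_def]
  refine integral_congr_ae ?_
  filter_upwards [hf.coeFn_toLp, hg.coeFn_toLp] with q h1 h2
  rw [h1, h2]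
  simp [mul_comm]

lemma inner32_eq_inner {f g : ℝ × ℝ → ℝ} (hf : MemLp f 2 μ) (hg : MemLp g 2 μ)
    {y v : ℝ → ℝ → ℝ} (hy : EqOnD y (Y f)) (hv : EqOnD v (Y g)) :
    inner32 y v = inner ℝ (hf.toLp f) (hg.toLp g) := by
  rw [inner32_Y hf hg hy hv, inner_toLp]

lemma norm32_eq_norm {f : ℝ × ℝ → ℝ} (hf : MemLp f 2 μ) {y : ℝ → ℝ → ℝ} (hy : EqOnD y (Y f)) :
    norm32 y = ‖hf.toLp f‖ := by
  rw [norm32, inner32_eq_inner hf hf hy hy, real_inner_self_eq_norm_sq,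
    Real.sqrt_sq (norm_nonneg _)]

lemma toLp_finsetSum {ℓ : ℕ → ℝ × ℝ → ℝ} (hℓ : ∀ i, MemLp (ℓ i) 2 μ) (c : ℕ → ℝ) (s : Finset ℕ)
    (hs : MemLp (fun q => ∑ i ∈ s, c i * ℓ i q) 2 μ) :
    hs.toLp _ = ∑ i ∈ s, c i • (hℓ i).toLp (ℓ i) := by
  induction s using Finset.induction_on with
  | empty =>
    simp only [Finset.sum_empty]
    exact MemLp.toLp_zero hs
  | insert i s hi ih =>
    have h1 : MemLp (fun q => ∑ i ∈ s, c i * ℓ i q) 2 μ :=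
      memLp_finsetSum _ fun i _ => (hℓ i).const_mul _
    rw [Finset.sum_insert hi, ← ih h1, ← MemLp.toLp_const_smul, ← MemLp.toLp_add]
    refine MemLp.toLp_congr _ _ (Filter.Eventually.of_forall fun q => ?_)
    simp [Finset.sum_insert hi]

/-- A sequence represented by densities that no nonzero element of the space is orthogonal to is
a complete system. -/
lemma isCompleteSystem32_of_orthogonal {ψ : ℕ → ℝ → ℝ → ℝ} {ℓ : ℕ → ℝ × ℝ → ℝ}
    (hℓ : ∀ i, MemLp (ℓ i) 2 μ) (hψ : ∀ i, EqOnD (ψ i) (Y (ℓ i)))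
    (h : ∀ y, MemW32 y → (∀ i, inner32 y (ψ i) = 0) → EqOnD y (fun _ _ => 0)) :
    IsCompleteSystem32 ψ := by
  refine ⟨fun i => (hψ i).memW32 (hℓ i), h, fun y hy ε hε => ?_⟩
  obtain ⟨f, hf, hyf⟩ := hy.exists_density
  set e : ℕ → Lp ℝ 2 μ := fun i => (hℓ i).toLp (ℓ i) with he
  have htop : (Submodule.span ℝ (range e)).topologicalClosure = ⊤ := by
    rw [Submodule.topologicalClosure_eq_top_iff, Submodule.eq_bot_iff]
    intro g hg
    have hg2 : MemLp (g : ℝ × ℝ → ℝ) 2 μ := Lp.memLp g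
    have hY : EqOnD (Y g) (Y g) := fun _ _ _ _ => rfl
    have h0 : EqOnD (Y g) (fun _ _ => 0) := by
      refine h _ (hY.memW32 hg2) fun i => ?_
      rw [inner32_eq_inner hg2 (hℓ i) hY (hψ i), Lp.toLp_coeFn]
      exact (Submodule.mem_orthogonal' _ _).1 hg _ (Submodule.subset_span ⟨i, rfl⟩)
    -- The representation is injective: the inner product of `Y g` with itself, computed with
    -- density g in both slots and then with density 0 in the second, gives ‖g‖² = 0.
    have hz : EqOnD (Y g) (Y 0) := h0.trans fun ξ _ η _ => (Y_zero ξ η).symm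
    have hn := inner32_eq_inner hg2 hg2 hY hY
    rw [inner32_Y hg2 MemLp.zero hY hz, Lp.toLp_coeFn] at hn
    exact inner_self_eq_zero.1 (hn.symm.trans (by simp))
  have hmem : hf.toLp f ∈ closure (Submodule.span ℝ (range e) : Set (Lp ℝ 2 μ)) := by
    rw [← Submodule.topologicalClosure_coe, htop]
    trivial
  obtain ⟨v, hv, hdist⟩ := Metric.mem_closure_iff.1 hmem ε hε
  -- The approximant is a finite combination; its support is enlarged to an initial segment, the
  -- extra coefficients being zero.
  obtain ⟨c, rfl⟩ := Finsupp.mem_span_range_iff_exists_finsupp.1 hv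
  obtain ⟨n, hn⟩ := c.support.exists_nat_subset_range
  refine ⟨n, c, ?_⟩
  have hsum : MemLp (fun q => ∑ i ∈ Finset.range n, c i * ℓ i q) 2 μ :=
    memLp_finsetSum _ fun i _ => (hℓ i).const_mul _
  have hY : EqOnD (fun ξ η => y ξ η - ∑ i ∈ Finset.range n, c i * ψ i ξ η)
      (Y (f - fun q => ∑ i ∈ Finset.range n, c i * ℓ i q)) := by
    intro ξ hξ η hη
    have hw := (isKer_Φ0.isWeight (mem_Icc_of_mem_I hξ))
    have hw' := (isKer_Ψ0.isWeight (mem_Icc_of_mem_I hη))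
    simp only [hyf ξ hξ η hη, fun i => hψ i ξ hξ η hη, Y, T, ← integral_const_mul]
    rw [← integral_finsetSum _ fun i _ =>
      (hw.integrable hw' ((hℓ i).integrable one_le_two)).const_mul _, ← integral_sub
      (hw.integrable hw' (hf.integrable one_le_two)) (integrable_finsetSum _ fun i _ =>
      (hw.integrable hw' ((hℓ i).integrable one_le_two)).const_mul _)]
    refine integral_congr_ae (Filter.Eventually.of_forall fun q => ?_)
    simp only [Pi.sub_apply, mul_sub, Finset.mul_sum]
    congr 1
    exact Finset.sum_congr rfl fun i _ => by ring
  rw [norm32_eq_norm (hf.sub hsum) hY, MemLp.toLp_sub hf hsum, toLp_finsetSum hℓ, ← dist_eq_norm]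
  rwa [Finsupp.sum_of_support_subset _ hn _ (by simp)] at hdist

end BurgersRK

/-! ### The theorem -/

theorem theorem3p2 :
    BurgersRK.IsReproducingKernel32 BurgersRK.K32 ∧
    ∀ (α : ℝ) (_hα0 : 0 < α) (_hα1 : α ≤ 1)
      (k₁ k₂ k₃ : ℝ → ℝ → ℝ)
      (_hk₁ : ContinuousOn (Function.uncurry k₁) BurgersRK.D)
      (_hk₂ : ContinuousOn (Function.uncurry k₂) BurgersRK.D)
      (_hk₃ : ContinuousOn (Function.uncurry k₃) BurgersRK.D)
      (p : ℕ → ℝ × ℝ)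
      (_hpD : ∀ i, p i ∈ BurgersRK.D)
      (_hdense : BurgersRK.D ⊆ closure (Set.range p))
      (_hL : BurgersRK.HasInverse (BurgersRK.opL α k₁ k₂ k₃)),
      BurgersRK.IsCompleteSystem32 (BurgersRK.psi (BurgersRK.opL α k₁ k₂ k₃) p) := by
  refine ⟨BurgersRK.isReproducingKernel32_K32, ?_⟩
  intro α _ hα1 k₁ k₂ k₃ hk₁ hk₂ hk₃ p hp hdense hL
  obtain ⟨b, hb, hcap⟩ := BurgersRK.exists_ker_caputo hα1
  have hℓ := fun i => BurgersRK.memLp_evalL hb k₁ k₂ k₃ (hp i)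
  have hψ := BurgersRK.eqOnD_psi (k₁ := k₁) (k₂ := k₂) (k₃ := k₃) hb hcap hp
  refine BurgersRK.isCompleteSystem32_of_orthogonal hℓ hψ fun y hy horth => ?_
  obtain ⟨f, hf, hyf⟩ := hy.exists_density
  have hf1 := hf.integrable one_le_two
  have h0 : BurgersRK.EqOnD (fun _ _ => 0) (BurgersRK.Y 0) :=
    fun ξ _ η _ => (BurgersRK.Y_zero ξ η).symm
  -- Injectivity is applied to y and 0, so it remains to show that L y vanishes on the whole square.
  refine hL y _ hy (h0.memW32 MemLp.zero) fun ξ hξ η hη => ?_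
  have hzero : BurgersRK.opL α k₁ k₂ k₃ (fun _ _ => 0) ξ η = 0 := by
    rw [BurgersRK.opL_eq_integral hb hcap (integrable_zero _ _ _) h0 (z := (ξ, η)) ⟨hξ, hη⟩]
    simp
  rw [hzero]
  have hcont := BurgersRK.continuousOn_opL hb hcap hk₁ hk₂ hk₃ hf1 hyf
  have hEq : EqOn (fun z : ℝ × ℝ => BurgersRK.opL α k₁ k₂ k₃ y z.1 z.2) (fun _ => 0)
      BurgersRK.D := by
    -- At the dense points L y equals the inner product with ψ_i, which is zero; continuity extends
    -- this to the square.
    refine EqOn.of_subset_closure (s := range p) ?_ hcont continuousOn_const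
      (range_subset_iff.2 hp) hdense
    rintro _ ⟨i, rfl⟩
    have := horth i
    rw [BurgersRK.inner32_Y hf (hℓ i) hyf (hψ i)] at this
    simp only [BurgersRK.opL_eq_integral hb hcap hf1 hyf (hp i)]
    rw [← this]
    exact integral_congr_ae (Filter.Eventually.of_forall fun q => mul_comm _ _)
  exact hEq (⟨hξ, hη⟩ : (ξ, η) ∈ BurgersRK.D)
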